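/- **Setting.** Fix integers $1\le q<K$ and a real $q\times K$ matrix $\widetilde G$ of rank $q$. All other quantities vary along an index $\nu\in\mathbb N$, usually suppressed: sample sizes $n_1,\dots,n_K$ with $n=n_1+\cdots+n_K$, dimensions $p\le m$, and a probability space. "As $n,p\to\infty$" means along any such sequence with $n\to\infty$ and $p\to\infty$ as $\nu\to\infty$; no relation between $n$ and $p$ is required. Put $D=\mathrm{diag}(n/n_1,\dots,n/n_K)$, $G=(\widetilde G D\widetilde G^{T})^{-1/2}\widetilde G$ and $(d_{\alpha\beta})_{\alpha,\beta=1}^{K}=G^{T}G$. Let $W=B+aa^{T}$ with $a=(a_1,\dots,a_p)^T\in\mathbb R^p$ and $B=\mathrm{diag}(b_1^2,\dots,b_p^2)$, $b_i>0$ ($a_i$ and $b_i^2$ are the mean and variance of the $i$-th weight density). For random vectors $Y_{\alpha i}\in\mathbb R^p$ ($1\le\alpha\le K$, $1\le i\le n_\alpha$) and vectors $\mu_\alpha\in\mathbb R^p$, let $X_{\alpha i}=Y_{\alpha i}-\mu_\alpha$ and $$T_{n0}=\sum_{\alpha=1}^{K} d_{\alpha\alpha}\,\frac{\sum_{i\ne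 j}X_{\alpha i}^{T}WX_{\alpha j}}{n_\alpha(n_\alpha-1)}+\sum_{\alpha\ne\beta}d_{\alpha\beta}\,\frac{\sum_{i,j}X_{\alpha i}^{T}WX_{\beta j}}{n_\alpha n_\beta},\qquad \sigma(T_{n0})=\sqrt{\mathrm{Var}(T_{n0})}.$$ **Assumptions.** * (A1) $Y_{\alpha i}=\Gamma_\alpha Z_{\alpha i}+\mu_\alpha$, where $\Gamma_\alpha$ is a $p\times m$ matrix, $p\le m$, with $\Gamma_\alpha\Gamma_\alpha^{T}=\Sigma_\alpha$. The $m$-dimensional random vectors $Z_{\alpha i}$ are mutually independent over all $\alpha,i$, identically distributed within each group $\alpha$, with $\mathrm E Z_{\alpha i}=0$ and $\mathrm{Cov}(Z_{\alpha i})=I_m$. * (A2) The components $z_{\alpha is}$ of $Z_{\alpha i}$ satisfy $\mathrm E z_{\alpha is}^4=3+\Delta<\infty$ with a constant $\Delta$ not depending on $\alpha,i,s,\nu$, and $\mathrm E\bigl(z_{\alpha is_1}^{\varsigma_1}\cdots z_{\alpha is_r}^{\varsigma_r}\bigr)=\mathrm E\bigl(z_{\alpha is_1}^{\varsigma_1}\bigr)\cdots\mathrm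 E\bigl(z_{\alpha is_r}^{\varsigma_r}\bigr)$ for all positive integers $r,\varsigma_1,\dots,\varsigma_r$ with $\sum_{l=1}^r\varsigma_l\le8$ and all distinct indices $s_1,\dots,s_r$. * (A3) $n_\alpha/n\to\tau_\alpha\in(0,1)$ for $\alpha=1,\dots,K$. * (A4) For all $\alpha,\beta,\gamma\in\{1,\dots,K\}$, $\mathrm{tr}(W\Sigma_\alpha W\Sigma_\beta W\Sigma_\gamma W\Sigma_\beta)=o\{\mathrm{tr}(W\Sigma_\alpha W\Sigma_\beta)\,\mathrm{tr}(W\Sigma_\gamma W\Sigma_\beta)\}$. In addition $\sigma(T_{n0})>0$ for all large $\nu$, so that the quotient below is defined (this is automatic from the other assumptions if, for all large $\nu$, every $\Sigma_\alpha\ne0$). **Theorem 2.2.** Under these assumptions, as $n,p\to\infty$, $$\frac{T_{n0}}{\sigma(T_{n0})}\ \xrightarrow{\ d\ }\ N(0,1).$$ -/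

import Mathlib

open MeasureTheory ProbabilityTheory Filter Topology Matrix

namespace GLHT

/-- The weight matrix `W = B + a aᵀ`, where `B = diag(b₁², …, b_p²)`. Here `a i` and `(b i)²` are
the mean and the variance of the `i`-th one-dimensional weight density. -/
def weightMatrix {p : ℕ} (a b : Fin p → ℝ) : Matrix (Fin p) (Fin p) ℝ :=
  Matrix.diagonal (fun i => b i ^ 2) + Matrix.vecMulVec a a

/-- The diagonal matrix `D = diag(n / n₁, …, n / n_K)`, `n = n₁ + ⋯ + n_K`. -/
noncomputable def ratioMatrix {K : ℕ} (n : Fin K → ℕ) : Matrix (Fin K) (Fin K) ℝ :=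
  Matrix.diagonal (fun α => ((∑ β, n β : ℕ) : ℝ) / (n α : ℝ))

/-- The normalized coefficient matrix `G = (G₀ D G₀ᵀ)^(-1/2) G₀`. The power `-1/2` of the symmetric
positive definite matrix `G₀ D G₀ᵀ` is taken in the functional calculus, that is, on its
eigenvalues. -/
noncomputable def normalizedContrast {q K : ℕ} (G₀ : Matrix (Fin q) (Fin K) ℝ) (n : Fin K → ℕ) :
    Matrix (Fin q) (Fin K) ℝ :=
  cfc (fun x : ℝ => x ^ (-(1 / 2) : ℝ)) (G₀ * ratioMatrix n * G₀ᵀ) * G₀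

/-- The coefficients `d_{αβ} = g_αᵀ g_β`, where `g_α` are the columns of `G`; so
`(d_{αβ}) = Gᵀ G`. -/
noncomputable def coeff {q K : ℕ} (G₀ : Matrix (Fin q) (Fin K) ℝ) (n : Fin K → ℕ) :
    Matrix (Fin K) (Fin K) ℝ :=
  (normalizedContrast G₀ n)ᵀ * normalizedContrast G₀ n

/-- The within-group U-statistic
`S⁰_{αα} = (∑_{i ≠ j} X_{αi}ᵀ W X_{αj}) / (n_α (n_α - 1))` of the vectors `x₁, …, x_N`. -/
noncomputable def withinU {p N : ℕ} (W : Matrix (Fin p) (Fin p) ℝ) (x : Fin N → Fin p → ℝ) : ℝ :=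
  (∑ i, ∑ j ∈ Finset.univ.filter (fun j => j ≠ i), x i ⬝ᵥ (W *ᵥ x j)) / ((N : ℝ) * ((N : ℝ) - 1))

/-- The between-group U-statistic
`S⁰_{αβ} = (∑_{i, j} X_{αi}ᵀ W X_{βj}) / (n_α n_β)` of the vectors `x₁, …, x_N` and
`y₁, …, y_M`. -/
noncomputable def betweenU {p N M : ℕ} (W : Matrix (Fin p) (Fin p) ℝ)
    (x : Fin N → Fin p → ℝ) (y : Fin M → Fin p → ℝ) : ℝ :=
  (∑ i, ∑ j, x i ⬝ᵥ (W *ᵥ y j)) / ((N : ℝ) * (M : ℝ))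

/-- The centred statistic
`T_{n0} = ∑_α d_{αα} S⁰_{αα} + ∑_{α ≠ β} d_{αβ} S⁰_{αβ}`,
formed from the centred observations `X_{αi} = Y_{αi} - μ_α`. -/
noncomputable def centredStatistic {K p : ℕ} {n : Fin K → ℕ} {Ω : Type*}
    (d : Matrix (Fin K) (Fin K) ℝ) (W : Matrix (Fin p) (Fin p) ℝ)
    (μ : Fin K → Fin p → ℝ) (Y : (α : Fin K) → Fin (n α) → Ω → Fin p → ℝ) (ω : Ω) : ℝ :=
  ∑ α, d α α * withinU W (fun i => Y α i ω - μ α) +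
    ∑ α, ∑ β ∈ Finset.univ.filter (fun β => β ≠ α),
      d α β * betweenU W (fun i => Y α i ω - μ α) (fun j => Y β j ω - μ β)

/-- The standard deviation `σ(T) = √Var(T)`. -/
noncomputable def stdDev {Ω : Type*} [MeasurableSpace Ω] (P : Measure Ω) (T : Ω → ℝ) : ℝ :=
  Real.sqrt (Var[T; P])

/-- The multivariate factor model: `Y_{αi} = Γ_α Z_{αi} + μ_α` with `Γ_α` a `p × m` matrix, `p ≤ m`,
`Γ_α Γ_αᵀ = Σ_α`. The vectors `Z_{αi}` are mutually independent over all `α` and `i`, identically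
distributed within each group, square integrable, centred, with identity covariance. -/
structure FactorModel {K p m : ℕ} {n : Fin K → ℕ} {Ω : Type*} [MeasurableSpace Ω] (P : Measure Ω)
    (μ : Fin K → Fin p → ℝ) (S : Fin K → Matrix (Fin p) (Fin p) ℝ)
    (Γ : Fin K → Matrix (Fin p) (Fin m) ℝ)
    (Z : (α : Fin K) → Fin (n α) → Ω → Fin m → ℝ)
    (Y : (α : Fin K) → Fin (n α) → Ω → Fin p → ℝ) : Prop where
  dim_le : p ≤ m
  factor : ∀ α, Γ α * (Γ α)ᵀ = S α
  model : ∀ α i ω, Y α i ω = Γ α *ᵥ Z α i ω + μ α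
  measurable : ∀ α i, Measurable (Z α i)
  indep : iIndepFun (fun k : (α : Fin K) × Fin (n α) => Z k.1 k.2) P
  identDistrib : ∀ α i j, IdentDistrib (Z α i) (Z α j) P P
  memLp_two : ∀ α i s, MemLp (fun ω => Z α i ω s) 2 P
  mean : ∀ α i s, ∫ ω, Z α i ω s ∂P = 0
  cov : ∀ α i s t,
    cov[fun ω => Z α i ω s, fun ω => Z α i ω t; P] = (1 : Matrix (Fin m) (Fin m) ℝ) s t

/-- The moment conditions: the components of all `Z_{αi}` have the same finite fourth moment
`3 + Δ`, and mixed moments of distinct components factorize up to total order `8`. -/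
structure PseudoIndependent {K m : ℕ} {n : Fin K → ℕ} {Ω : Type*} [MeasurableSpace Ω]
    (P : Measure Ω) (Δ : ℝ) (Z : (α : Fin K) → Fin (n α) → Ω → Fin m → ℝ) : Prop where
  integrable_four : ∀ α i s, Integrable (fun ω => Z α i ω s ^ 4) P
  moment_four : ∀ α i s, ∫ ω, Z α i ω s ^ 4 ∂P = 3 + Δ
  factorize : ∀ α i (r : ℕ) (s : Fin r → Fin m) (e : Fin r → ℕ), 0 < r → Function.Injective s →
    (∀ k, 0 < e k) → ∑ k, e k ≤ 8 →
      ∫ ω, ∏ k, Z α i ω (s k) ^ e k ∂P = ∏ k, ∫ ω, Z α i ω (s k) ^ e k ∂P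

end GLHT

/-!
# Asymptotic normality of the weighted U-statistic

Write `W = Lᵀ L`, `Q_α = L Γ_α`, and let `z` be the vector of all the components of all the `Z_{αi}`.
Divided by its standard deviation, the statistic is `T = zᵀ M z / 2`, where `M` is a symmetric block
matrix indexed by the observations, with zero diagonal blocks, off-diagonal blocks proportional to
`Q_αᵀ Q_β`, and `‖M‖² = 2` (Frobenius norm): see `centredStatistic_eq_quadForm`.

The limit law comes from a Stein-type argument on the characteristic function `φ(t) = E e^{itT}`. Let
`T_k = ∑ₛ z_{ks} (M z)_{ks}` be the part of `T` that involves the block `k`, so that `2 T = ∑ₖ T_k`,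
and let `q_k = ∑ₛ (M z)_{ks}²`. Both `T - T_k` and `q_k` are functions of the other blocks; given
these, `T_k` has mean zero and variance `q_k`. Expanding `e^{itT}` around `e^{it(T - T_k)}`, and then
going back to `e^{itT}`, gives
`E (T_k e^{itT}) = i t E (q_k e^{itT}) + O(t² E (|T_k|³ + q_k |T_k|))`
(`IsBlockNoise.norm_integral_blockForm_sub_le`). Summing over `k`, with
`V = ∑ₖ q_k / 2 = zᵀ M² z / 2`,
```
φ'(t) + t φ(t) = t E ((1 - V) e^{itT}) + error,
```
and the differential equation `φ' = -t φ` characterizes the Gaussian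
(`norm_sub_exp_le_of_hasDerivAt`).

Two quantities have to vanish in the limit. First, `E V = 1` and `Var V ≤ C ‖M²‖²`, because the second
moment of a quadratic form in `z` involves only moments of order four, which are those of independent
variables (`IsWhiteNoise.integral_quadForm_sq`). The trace condition says that
`‖M_{kl} M_{ll'}‖² = o(‖M_{kl}‖² ‖M_{ll'}‖²)` for the blocks of `M`, and by Cauchy-Schwarz this
implies `‖M²‖² = o(‖M‖⁴)` (`sum_mul_self_sq_le`). Second, the error is controlled by
`∑ₖ (E T_k⁴ + E q_k²) ≤ C ∑ₖ h_k²`, where `h_k` is the squared norm of the `k`-th block row of `M`.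
All block rows of one group have the same norm, so `h_k ≤ 2 / n_α → 0` while `∑ₖ h_k = 2`
(`mul_blockEnergy_interaction_le`).
-/

namespace GLHT

/-! ### Fourth-order white noise and quadratic forms -/

variable {Ω : Type*} [MeasurableSpace Ω] {P : Measure Ω}

lemma memLp_two_mul {f g : Ω → ℝ} (hf : MemLp f 4 P) (hg : MemLp g 4 P) :
    MemLp (fun ω => f ω * g ω) 2 P := by
  have : ENNReal.HolderTriple 4 4 2 := ⟨by
    have h4 : (4 : ENNReal) = 2 * 2 := by norm_num
    rw [h4, ENNReal.mul_inv (by simp) (by simp), ← mul_add, ENNReal.inv_two_add_inv_two, mul_one]⟩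
  exact hg.mul hf

lemma integrable_mul_of_memLp_two {f g : Ω → ℝ} (hf : MemLp f 2 P) (hg : MemLp g 2 P) :
    Integrable (fun ω => f ω * g ω) P :=
  hf.integrable_mul hg

/-- The random variables `z a` have mixed moments up to order four of a family of independent
standardized variables with fourth moment `3 + Δ`. -/
structure IsWhiteNoise {σ : Type*} [DecidableEq σ] (P : Measure Ω) (Δ : ℝ) (z : σ → Ω → ℝ) :
    Prop where
  memLp_four : ∀ a, MemLp (z a) 4 P
  moment_two : ∀ a b, ∫ ω, z a ω * z b ω ∂P = if a = b then 1 else 0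
  moment_four : ∀ a b c d, ∫ ω, (z a ω * z b ω) * (z c ω * z d ω) ∂P =
    (if a = b then 1 else 0) * (if c = d then 1 else 0) +
    (if a = c then 1 else 0) * (if b = d then 1 else 0) +
    (if a = d then 1 else 0) * (if b = c then 1 else 0) +
    Δ * ((if a = b then 1 else 0) * (if a = c then 1 else 0) * (if a = d then 1 else 0))

/-- The quadratic form `x ↦ xᵀ B x`. -/
def quadForm {σ : Type*} [Fintype σ] (B : Matrix σ σ ℝ) (x : σ → ℝ) : ℝ :=
  ∑ a, ∑ b, B a b * (x a * x b)

lemma sum_diag_sq_le {σ : Type*} [Fintype σ] (B : Matrix σ σ ℝ) : ∑ a, B a a ^ 2 ≤ ∑ a, ∑ b, B a b ^ 2 :=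
  Finset.sum_le_sum fun a _ =>
    Finset.single_le_sum (f := fun b => B a b ^ 2) (fun _ _ => sq_nonneg _) (Finset.mem_univ a)

section WhiteNoise

variable {σ : Type*} [Fintype σ] [DecidableEq σ] {Δ : ℝ} {z : σ → Ω → ℝ}

lemma IsWhiteNoise.memLp_quadForm (hz : IsWhiteNoise P Δ z) (B : Matrix σ σ ℝ) :
    MemLp (fun ω => quadForm B (fun a => z a ω)) 2 P := by
  unfold quadForm
  exact memLp_finsetSum _ fun a _ => memLp_finsetSum _ fun b _ =>
    (memLp_two_mul (hz.memLp_four a) (hz.memLp_four b)).const_mul _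

lemma IsWhiteNoise.integral_quadForm [IsFiniteMeasure P] (hz : IsWhiteNoise P Δ z)
    (B : Matrix σ σ ℝ) :
    ∫ ω, quadForm B (fun a => z a ω) ∂P = B.trace := by
  have hi : ∀ a b, Integrable (fun ω => B a b * (z a ω * z b ω)) P := fun a b =>
    ((memLp_two_mul (hz.memLp_four a) (hz.memLp_four b)).integrable one_le_two).const_mul _
  unfold quadForm
  rw [integral_finsetSum _ fun a _ => integrable_finsetSum _ fun b _ => hi a b]
  simp_rw [integral_finsetSum _ fun b _ => hi _ b, integral_const_mul, hz.moment_two]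
  simp [Matrix.trace]

lemma IsWhiteNoise.integral_quadForm_sq (hz : IsWhiteNoise P Δ z) {B : Matrix σ σ ℝ}
    (hB : ∀ a b, B a b = B b a) :
    ∫ ω, quadForm B (fun a => z a ω) ^ 2 ∂P =
      B.trace ^ 2 + 2 * ∑ a, ∑ b, B a b ^ 2 + Δ * ∑ a, B a a ^ 2 := by
  have hi : ∀ a b c d, Integrable
      (fun ω => B a b * B c d * ((z a ω * z b ω) * (z c ω * z d ω))) P := fun a b c d =>
    (integrable_mul_of_memLp_two (memLp_two_mul (hz.memLp_four a) (hz.memLp_four b))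
      (memLp_two_mul (hz.memLp_four c) (hz.memLp_four d))).const_mul _
  have hexp : ∀ ω, quadForm B (fun a => z a ω) ^ 2 =
      ∑ a, ∑ b, ∑ c, ∑ d, B a b * B c d * ((z a ω * z b ω) * (z c ω * z d ω)) := by
    intro ω
    rw [sq, quadForm, Finset.sum_mul]
    refine Finset.sum_congr rfl fun a _ => ?_
    rw [Finset.sum_mul]
    refine Finset.sum_congr rfl fun b _ => ?_
    rw [Finset.mul_sum]
    refine Finset.sum_congr rfl fun c _ => ?_
    rw [Finset.mul_sum]
    exact Finset.sum_congr rfl fun d _ => by ring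
  simp_rw [hexp]
  rw [integral_finsetSum _ fun a _ => integrable_finsetSum _ fun b _ =>
    integrable_finsetSum _ fun c _ => integrable_finsetSum _ fun d _ => hi a b c d]
  simp_rw [integral_finsetSum _ fun b _ => integrable_finsetSum _ fun c _ =>
    integrable_finsetSum _ fun d _ => hi _ b c d]
  simp_rw [integral_finsetSum _ fun c _ => integrable_finsetSum _ fun d _ => hi _ _ c d]
  simp_rw [integral_finsetSum _ fun d _ => hi _ _ _ d, integral_const_mul, hz.moment_four]
  have hsplit : ∀ a b c d : σ, B a b * B c d *
      ((if a = b then 1 else 0) * (if c = d then 1 else 0) +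
      (if a = c then 1 else 0) * (if b = d then 1 else 0) +
      (if a = d then 1 else 0) * (if b = c then 1 else 0) +
      Δ * ((if a = b then 1 else 0) * (if a = c then 1 else 0) * (if a = d then 1 else 0))) =
      (if a = b then (if c = d then B a b * B c d else 0) else 0) +
      (if b = d then (if a = c then B a b * B c d else 0) else 0) +
      (if a = d then (if b = c then B a b * B c d else 0) else 0) +
      (if a = d then (if a = c then (if a = b then Δ * (B a b * B c d) else 0) else 0) else 0) := by
    intro a b c d
    split_ifs <;> ring
  simp_rw [hsplit, Finset.sum_add_distrib]
  have h1 : ∑ a, ∑ b, ∑ c, ∑ d, (if a = b then (if c = d then B a b * B c d else 0) else 0)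
      = B.trace ^ 2 := by
    have : ∀ a b : σ, ∑ c, ∑ d, (if a = b then (if c = d then B a b * B c d else 0) else 0)
        = if a = b then B a b * B.trace else 0 := by
      intro a b
      split_ifs
      · simp [Matrix.trace, Finset.mul_sum]
      · simp
    simp_rw [this]
    simp [Matrix.trace, sq, Finset.sum_mul]
  have h2 : ∑ a, ∑ b, ∑ c, ∑ d, (if b = d then (if a = c then B a b * B c d else 0) else 0)
      = ∑ a, ∑ b, B a b ^ 2 := by
    simp [sq]
  have h3 : ∑ a, ∑ b, ∑ c, ∑ d, (if a = d then (if b = c then B a b * B c d else 0) else 0)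
      = ∑ a, ∑ b, B a b ^ 2 := by
    simp only [Finset.sum_ite_eq, Finset.mem_univ, if_true]
    exact Finset.sum_congr rfl fun a _ => Finset.sum_congr rfl fun b _ => by rw [hB b a]; ring
  have h4 : ∑ a, ∑ b, ∑ c, ∑ d,
      (if a = d then (if a = c then (if a = b then Δ * (B a b * B c d) else 0) else 0) else 0)
      = Δ * ∑ a, B a a ^ 2 := by
    simp [sq, Finset.mul_sum]
  rw [h1, h2, h3, h4]
  ring

lemma IsWhiteNoise.integral_quadForm_sq_le (hz : IsWhiteNoise P Δ z) {B : Matrix σ σ ℝ}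
    (hB : ∀ a b, B a b = B b a) :
    ∫ ω, quadForm B (fun a => z a ω) ^ 2 ∂P ≤
      B.trace ^ 2 + (2 + |Δ|) * ∑ a, ∑ b, B a b ^ 2 := by
  rw [hz.integral_quadForm_sq hB]
  have h1 := sum_diag_sq_le B
  have h0 : 0 ≤ ∑ a, B a a ^ 2 := Finset.sum_nonneg fun a _ => sq_nonneg _
  nlinarith [mul_le_mul (le_abs_self Δ) le_rfl h0 (abs_nonneg Δ),
    mul_le_mul_of_nonneg_left h1 (abs_nonneg Δ)]

lemma IsWhiteNoise.integral_quadForm_sub_trace_sq_le [IsProbabilityMeasure P]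
    (hz : IsWhiteNoise P Δ z) {B : Matrix σ σ ℝ} (hB : ∀ a b, B a b = B b a) :
    ∫ ω, (quadForm B (fun a => z a ω) - B.trace) ^ 2 ∂P ≤
      (2 + |Δ|) * ∑ a, ∑ b, B a b ^ 2 := by
  have hm := hz.memLp_quadForm B
  have hi := hm.integrable one_le_two
  have h2 : Integrable (fun ω => quadForm B (fun a => z a ω) ^ 2) P := hm.integrable_sq
  have h1 : Integrable (fun ω => 2 * B.trace * quadForm B (fun a => z a ω)) P := hi.const_mul _
  have h3 : Integrable (fun ω => quadForm B (fun a => z a ω) ^ 2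
      - 2 * B.trace * quadForm B (fun a => z a ω)) P := h2.sub h1
  have hexp : ∀ ω, (quadForm B (fun a => z a ω) - B.trace) ^ 2 =
      quadForm B (fun a => z a ω) ^ 2 - 2 * B.trace * quadForm B (fun a => z a ω)
        + B.trace ^ 2 := fun ω => by ring
  simp_rw [hexp]
  rw [integral_add h3 (integrable_const _), integral_sub h2 h1, integral_const_mul,
    hz.integral_quadForm]
  have := hz.integral_quadForm_sq_le hB
  simp only [integral_const, probReal_univ, one_smul]
  linarith

/-- A linear form in white noise satisfies `E (vᵀz)⁴ ≤ (3 + |Δ|) |v|⁴`. -/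
lemma IsWhiteNoise.integral_linear_pow_four_le (hz : IsWhiteNoise P Δ z) (v : σ → ℝ) :
    ∫ ω, (∑ a, v a * z a ω) ^ 4 ∂P ≤ (3 + |Δ|) * (∑ a, v a ^ 2) ^ 2 := by
  have h := hz.integral_quadForm_sq_le (B := Matrix.vecMulVec v v)
    (fun a b => by simp [Matrix.vecMulVec_apply, mul_comm])
  have e1 : ∀ ω, quadForm (Matrix.vecMulVec v v) (fun a => z a ω) ^ 2
      = (∑ a, v a * z a ω) ^ 4 := by
    intro ω
    have : quadForm (Matrix.vecMulVec v v) (fun a => z a ω) = (∑ a, v a * z a ω) ^ 2 := by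
      rw [sq, Finset.sum_mul_sum, quadForm]
      exact Finset.sum_congr rfl fun a _ => Finset.sum_congr rfl fun b _ => by
        rw [Matrix.vecMulVec_apply]; ring
    rw [this]; ring
  have e2 : (Matrix.vecMulVec v v).trace = ∑ a, v a ^ 2 := by
    simp [Matrix.trace, Matrix.vecMulVec_apply, sq]
  have e3 : ∑ a, ∑ b, Matrix.vecMulVec v v a b ^ 2 = (∑ a, v a ^ 2) ^ 2 := by
    rw [sq, Finset.sum_mul_sum]
    exact Finset.sum_congr rfl fun a _ => Finset.sum_congr rfl fun b _ => by
      rw [Matrix.vecMulVec_apply]; ring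
  simp_rw [e1] at h
  rw [e2, e3] at h
  linarith

end WhiteNoise

/-! ### Quadratic forms with vanishing diagonal blocks in independent blocks -/

section Blocks

variable {ι κ : Type*}

/-- The array `x` with the entries of the block `k` replaced by zero. -/
def eraseBlock [DecidableEq ι] (k : ι) (x : ι × κ → ℝ) (a : ι × κ) : ℝ := if a.1 = k then 0 else x a

/-- The part `T_k = ∑ₛ x_{ks} (M x)_{ks}` of the quadratic form of `M` that involves block `k`. -/
def blockForm [Fintype ι] [Fintype κ] (M : Matrix (ι × κ) (ι × κ) ℝ) (k : ι) (x : ι × κ → ℝ) : ℝ :=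
  ∑ s, x (k, s) * (M *ᵥ x) (k, s)

/-- The quantity `q_k = ∑ₛ (M x)_{ks}²`; when the diagonal blocks of `M` vanish and the block `k` is
standardized, it is the conditional variance of `T_k` given the other blocks. -/
def blockSq [Fintype ι] [Fintype κ] (M : Matrix (ι × κ) (ι × κ) ℝ) (k : ι) (x : ι × κ → ℝ) : ℝ :=
  ∑ s, (M *ᵥ x) (k, s) ^ 2

/-- The squared Frobenius norm of the `k`-th block row of `M`. -/
def blockEnergy [Fintype ι] [Fintype κ] (M : Matrix (ι × κ) (ι × κ) ℝ) (k : ι) : ℝ :=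
  ∑ s, ∑ b, M (k, s) b ^ 2

/-- The Gram matrix `M_kᵀ M_k` of the `k`-th block row `M_k` of `M`. -/
def blockGram [Fintype κ] (M : Matrix (ι × κ) (ι × κ) ℝ) (k : ι) :
    Matrix (ι × κ) (ι × κ) ℝ :=
  fun a b => ∑ s, M (k, s) a * M (k, s) b

variable [Fintype ι] [Fintype κ] {M : Matrix (ι × κ) (ι × κ) ℝ}

lemma quadForm_eq_sum_mul_mulVec {σ : Type*} [Fintype σ] (B : Matrix σ σ ℝ) (x : σ → ℝ) :
    quadForm B x = ∑ a, x a * (B *ᵥ x) a := by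
  simp only [quadForm, Matrix.mulVec, dotProduct, Finset.mul_sum]
  exact Finset.sum_congr rfl fun a _ => Finset.sum_congr rfl fun b _ => by ring

lemma sum_blockForm (M : Matrix (ι × κ) (ι × κ) ℝ) (x : ι × κ → ℝ) :
    ∑ k, blockForm M k x = quadForm M x := by
  rw [quadForm_eq_sum_mul_mulVec, Fintype.sum_prod_type]; rfl

lemma blockSq_eq_quadForm (M : Matrix (ι × κ) (ι × κ) ℝ) (k : ι) (x : ι × κ → ℝ) :
    blockSq M k x = quadForm (blockGram M k) x := by
  simp only [blockSq, quadForm, blockGram, Matrix.mulVec, dotProduct, sq, Finset.sum_mul_sum]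
  simp only [Finset.sum_mul]
  rw [Finset.sum_comm]
  refine Finset.sum_congr rfl fun a _ => ?_
  rw [Finset.sum_comm]
  exact Finset.sum_congr rfl fun b _ => Finset.sum_congr rfl fun s _ => by ring

lemma trace_blockGram (M : Matrix (ι × κ) (ι × κ) ℝ) (k : ι) :
    (blockGram M k).trace = blockEnergy M k := by
  simp only [Matrix.trace, Matrix.diag, blockGram, blockEnergy, sq]
  rw [Finset.sum_comm]

omit [Fintype ι] in
lemma blockGram_symm (M : Matrix (ι × κ) (ι × κ) ℝ) (k : ι) (a b : ι × κ) :
    blockGram M k a b = blockGram M k b a :=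
  Finset.sum_congr rfl fun _ _ => mul_comm _ _

lemma blockSq_nonneg (M : Matrix (ι × κ) (ι × κ) ℝ) (k : ι) (x : ι × κ → ℝ) : 0 ≤ blockSq M k x :=
  Finset.sum_nonneg fun _ _ => sq_nonneg _

lemma blockEnergy_nonneg (M : Matrix (ι × κ) (ι × κ) ℝ) (k : ι) : 0 ≤ blockEnergy M k :=
  Finset.sum_nonneg fun _ _ => Finset.sum_nonneg fun _ _ => sq_nonneg _

lemma sum_blockEnergy (M : Matrix (ι × κ) (ι × κ) ℝ) :
    ∑ k, blockEnergy M k = ∑ a, ∑ b, M a b ^ 2 := by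
  rw [Fintype.sum_prod_type (f := fun a => ∑ b, M a b ^ 2)]; rfl

/-- `‖M_kᵀ M_k‖² ≤ ‖M_k‖⁴` in the Frobenius norm. -/
lemma sum_blockGram_sq_le (M : Matrix (ι × κ) (ι × κ) ℝ) (k : ι) :
    ∑ a, ∑ b, blockGram M k a b ^ 2 ≤ blockEnergy M k ^ 2 := by
  have h : ∀ a b, blockGram M k a b ^ 2 ≤ (∑ s, M (k, s) a ^ 2) * ∑ s, M (k, s) b ^ 2 :=
    fun a b => Finset.sum_mul_sq_le_sq_mul_sq _ _ _
  refine (Finset.sum_le_sum fun a _ => Finset.sum_le_sum fun b _ => h a b).trans_eq ?_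
  rw [← Finset.sum_mul_sum, blockEnergy, Finset.sum_comm (f := fun s b => M (k, s) b ^ 2), sq]

lemma sum_blockSq (hM : ∀ a b, M a b = M b a) (x : ι × κ → ℝ) :
    ∑ k, blockSq M k x = quadForm (M * M) x := by
  have h1 : ∑ k, blockSq M k x = ∑ a, (M *ᵥ x) a ^ 2 := by
    rw [Fintype.sum_prod_type]; rfl
  have hMt : Mᵀ = M := by ext a b; exact hM b a
  rw [h1, quadForm_eq_sum_mul_mulVec, ← Matrix.mulVec_mulVec]
  change _ = x ⬝ᵥ (M *ᵥ (M *ᵥ x))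
  rw [Matrix.dotProduct_mulVec, ← Matrix.mulVec_transpose, hMt]
  simp [dotProduct, sq]

section
variable [DecidableEq ι]

/-- If the diagonal blocks of `M` vanish, block `k` of `M x` does not depend on block `k` of
`x`. -/
lemma mulVec_eraseBlock (hM0 : ∀ k s t, M (k, s) (k, t) = 0) (k : ι) (s : κ) (x : ι × κ → ℝ) :
    (M *ᵥ eraseBlock k x) (k, s) = (M *ᵥ x) (k, s) := by
  simp only [Matrix.mulVec, dotProduct]
  refine Finset.sum_congr rfl fun b _ => ?_
  unfold eraseBlock
  split_ifs with h
  · obtain ⟨l, t⟩ := b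
    obtain rfl : l = k := h
    simp [hM0]
  · rfl

lemma quadForm_eq_eraseBlock (hM : ∀ a b, M a b = M b a) (hM0 : ∀ k s t, M (k, s) (k, t) = 0)
    (k : ι) (x : ι × κ → ℝ) :
    quadForm M x = quadForm M (eraseBlock k x) + 2 * blockForm M k x := by
  set o : ι × κ → ℝ := fun a => if a.1 = k then x a else 0 with ho
  have hterm : ∀ a b, M a b * (x a * x b) =
      M a b * (eraseBlock k x a * eraseBlock k x b) + (M a b * (o a * x b) + M b a * (o b * x a)) := by
    rintro ⟨l, s⟩ ⟨l', t⟩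
    rw [hM (l', t) (l, s)]
    simp only [ho, eraseBlock]
    split_ifs with h1 h2
    · subst h1; subst h2; simp [hM0]
    · ring
    · ring
    · ring
  have hB : ∑ a, ∑ b, M a b * (o a * x b) = blockForm M k x := by
    have : ∀ a, ∑ b, M a b * (o a * x b) = o a * (M *ᵥ x) a := fun a => by
      simp only [Matrix.mulVec, dotProduct, Finset.mul_sum]
      exact Finset.sum_congr rfl fun b _ => by ring
    simp_rw [this]
    rw [Fintype.sum_prod_type, Finset.sum_eq_single k]
    · simp [ho, blockForm]
    · intro l _ hl
      simp [ho, hl]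
    · simp
  have hB' : ∑ a, ∑ b, M b a * (o b * x a) = blockForm M k x := by
    rw [Finset.sum_comm, hB]
  unfold quadForm
  simp_rw [hterm, Finset.sum_add_distrib]
  rw [hB, hB']
  ring

end

end Blocks

section BlockNoise

variable {Ω : Type*} [MeasurableSpace Ω] {P : Measure Ω}
variable {ι κ : Type*} [Fintype ι] [DecidableEq ι] [Fintype κ] [DecidableEq κ]

/-- White noise up to order four, indexed by `ι × κ`, whose blocks `(z_{ks})ₛ` are centred and each
independent of the joint array of the other blocks. -/
structure IsBlockNoise (P : Measure Ω) (Δ : ℝ) (z : ι × κ → Ω → ℝ) : Prop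
    extends IsWhiteNoise P Δ z where
  measurable : ∀ a, Measurable (z a)
  mean : ∀ a, ∫ ω, z a ω ∂P = 0
  indep : ∀ k, IndepFun (fun ω s => z (k, s) ω) (fun ω => eraseBlock k fun a => z a ω) P

variable {Δ : ℝ} {z : ι × κ → Ω → ℝ} {M : Matrix (ι × κ) (ι × κ) ℝ}

lemma IsWhiteNoise.memLp_mulVec (hz : IsWhiteNoise P Δ z) (M : Matrix (ι × κ) (ι × κ) ℝ)
    (a : ι × κ) : MemLp (fun ω => (M *ᵥ fun b => z b ω) a) 4 P := by
  simp only [Matrix.mulVec, dotProduct]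
  exact memLp_finsetSum _ fun b _ => (hz.memLp_four b).const_mul _

lemma IsWhiteNoise.memLp_blockForm (hz : IsWhiteNoise P Δ z) (M : Matrix (ι × κ) (ι × κ) ℝ)
    (k : ι) : MemLp (fun ω => blockForm M k fun a => z a ω) 2 P :=
  memLp_finsetSum _ fun s _ => memLp_two_mul (hz.memLp_four (k, s)) (hz.memLp_mulVec M (k, s))

lemma IsWhiteNoise.memLp_blockSq (hz : IsWhiteNoise P Δ z) (M : Matrix (ι × κ) (ι × κ) ℝ)
    (k : ι) : MemLp (fun ω => blockSq M k fun a => z a ω) 2 P := by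
  simp_rw [blockSq_eq_quadForm]
  exact hz.memLp_quadForm _

lemma measurable_mulVec {σ : Type*} [Fintype σ] (B : Matrix σ σ ℝ) (a : σ) :
    Measurable fun x : σ → ℝ => (B *ᵥ x) a := by
  simp only [Matrix.mulVec, dotProduct]
  fun_prop

lemma measurable_quadForm {σ : Type*} [Fintype σ] (B : Matrix σ σ ℝ) :
    Measurable (quadForm B) := by
  unfold quadForm
  fun_prop

omit [Fintype ι] [DecidableEq κ] [Fintype κ] in
lemma measurable_eraseBlock (k : ι) :
    Measurable fun x : ι × κ → ℝ => eraseBlock k x := by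
  refine measurable_pi_lambda _ fun a => ?_
  unfold eraseBlock
  split_ifs <;> fun_prop

omit [Fintype ι] [Fintype κ] in
lemma IsBlockNoise.integral_comp_mul_comp (hz : IsBlockNoise P Δ z) (k : ι) {f : (κ → ℝ) → ℂ}
    {g : (ι × κ → ℝ) → ℂ} (hf : Measurable f) (hg : Measurable g) :
    ∫ ω, f (fun s => z (k, s) ω) * g (eraseBlock k fun a => z a ω) ∂P =
      (∫ ω, f (fun s => z (k, s) ω) ∂P) * ∫ ω, g (eraseBlock k fun a => z a ω) ∂P :=
  (hz.indep k).integral_fun_comp_mul_comp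
    (measurable_pi_lambda _ fun _ => hz.measurable _).aemeasurable
    ((measurable_eraseBlock k).comp (measurable_pi_lambda _ hz.measurable)).aemeasurable
    hf.aestronglyMeasurable hg.aestronglyMeasurable

lemma integrable_mul_unit {f : Ω → ℝ} {g : Ω → ℂ} (hf : Integrable f P)
    (hg : AEStronglyMeasurable g P) (hg1 : ∀ ω, ‖g ω‖ ≤ 1) :
    Integrable (fun ω => (f ω : ℂ) * g ω) P :=
  (hf.ofReal (𝕜 := ℂ)).mul_bdd hg (Eventually.of_forall hg1)

/-- `T_k` is centred given the other blocks. -/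
lemma IsBlockNoise.integral_blockForm_mul [IsFiniteMeasure P] (hz : IsBlockNoise P Δ z)
    (hM0 : ∀ k s t, M (k, s) (k, t) = 0) (k : ι) {g : (ι × κ → ℝ) → ℂ} (hg : Measurable g)
    (hg1 : ∀ x, ‖g x‖ ≤ 1) :
    ∫ ω, (blockForm M k (fun a => z a ω) : ℂ) * g (eraseBlock k fun a => z a ω) ∂P = 0 := by
  have hzm : Measurable fun ω a => z a ω := measurable_pi_lambda _ hz.measurable
  have hgm : AEStronglyMeasurable (fun ω => g (eraseBlock k fun a => z a ω)) P :=
    (hg.comp ((measurable_eraseBlock k).comp hzm)).aestronglyMeasurable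
  have hexp : ∀ ω, (blockForm M k (fun a => z a ω) : ℂ) * g (eraseBlock k fun a => z a ω) =
      ∑ s, ((z (k, s) ω * (M *ᵥ fun a => z a ω) (k, s) : ℝ) : ℂ) *
        g (eraseBlock k fun a => z a ω) := by
    intro ω
    rw [blockForm, Complex.ofReal_sum, Finset.sum_mul]
  simp_rw [hexp]
  rw [integral_finsetSum]
  · refine Finset.sum_eq_zero fun s _ => ?_
    have h := hz.integral_comp_mul_comp k (f := fun x => (x s : ℂ))
      (g := fun x => ((M *ᵥ x) (k, s) : ℂ) * g x) (by fun_prop)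
      ((Complex.measurable_ofReal.comp (measurable_mulVec M _)).mul hg)
    simp_rw [mulVec_eraseBlock hM0] at h
    simp_rw [Complex.ofReal_mul, mul_assoc]
    rw [h, integral_complex_ofReal, hz.mean]
    simp
  · intro s _
    exact integrable_mul_unit ((memLp_two_mul (hz.memLp_four (k, s))
      (hz.memLp_mulVec M (k, s))).integrable one_le_two) hgm fun ω => hg1 _

/-- The conditional second moment of `T_k` given the other blocks is `q_k`. -/
lemma IsBlockNoise.integral_blockForm_sq_mul [IsFiniteMeasure P] (hz : IsBlockNoise P Δ z)
    (hM0 : ∀ k s t, M (k, s) (k, t) = 0) (k : ι) {g : (ι × κ → ℝ) → ℂ} (hg : Measurable g)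
    (hg1 : ∀ x, ‖g x‖ ≤ 1) :
    ∫ ω, ((blockForm M k (fun a => z a ω) ^ 2 : ℝ) : ℂ) * g (eraseBlock k fun a => z a ω) ∂P =
      ∫ ω, (blockSq M k (fun a => z a ω) : ℂ) * g (eraseBlock k fun a => z a ω) ∂P := by
  have hzm : Measurable fun ω a => z a ω := measurable_pi_lambda _ hz.measurable
  have hgm : AEStronglyMeasurable (fun ω => g (eraseBlock k fun a => z a ω)) P :=
    (hg.comp ((measurable_eraseBlock k).comp hzm)).aestronglyMeasurable
  have hSS : ∀ s t, MemLp (fun ω => (M *ᵥ fun a => z a ω) (k, s) * (M *ᵥ fun a => z a ω) (k, t)) 2 P :=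
    fun s t => memLp_two_mul (hz.memLp_mulVec M (k, s)) (hz.memLp_mulVec M (k, t))
  have hZZ : ∀ s t, MemLp (fun ω => z (k, s) ω * z (k, t) ω) 2 P :=
    fun s t => memLp_two_mul (hz.memLp_four (k, s)) (hz.memLp_four (k, t))
  have hexp : ∀ ω, ((blockForm M k (fun a => z a ω) ^ 2 : ℝ) : ℂ) *
      g (eraseBlock k fun a => z a ω) =
      ∑ s, ∑ t, (((z (k, s) ω * z (k, t) ω) *
        ((M *ᵥ fun a => z a ω) (k, s) * (M *ᵥ fun a => z a ω) (k, t)) : ℝ) : ℂ) *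
        g (eraseBlock k fun a => z a ω) := by
    intro ω
    rw [blockForm, sq, Finset.sum_mul_sum, Complex.ofReal_sum, Finset.sum_mul]
    refine Finset.sum_congr rfl fun s _ => ?_
    rw [Complex.ofReal_sum, Finset.sum_mul]
    refine Finset.sum_congr rfl fun t _ => ?_
    congr 2
    ring
  have hexp' : ∀ ω, (blockSq M k (fun a => z a ω) : ℂ) * g (eraseBlock k fun a => z a ω) =
      ∑ s, (((M *ᵥ fun a => z a ω) (k, s) * (M *ᵥ fun a => z a ω) (k, s) : ℝ) : ℂ) *
        g (eraseBlock k fun a => z a ω) := by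
    intro ω
    simp only [blockSq, sq]
    rw [Complex.ofReal_sum, Finset.sum_mul]
  have hint : ∀ s t, Integrable (fun ω => (((z (k, s) ω * z (k, t) ω) *
        ((M *ᵥ fun a => z a ω) (k, s) * (M *ᵥ fun a => z a ω) (k, t)) : ℝ) : ℂ) *
        g (eraseBlock k fun a => z a ω)) P := fun s t =>
    integrable_mul_unit (integrable_mul_of_memLp_two (hZZ s t) (hSS s t)) hgm fun ω => hg1 _
  simp_rw [hexp, hexp']
  rw [integral_finsetSum _ fun s _ => integrable_finsetSum _ fun t _ => hint s t,
    integral_finsetSum _ fun s _ => integrable_mul_unit ((hSS s s).integrable one_le_two) hgm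
      fun ω => hg1 _]
  refine Finset.sum_congr rfl fun s _ => ?_
  rw [integral_finsetSum _ fun t _ => hint s t]
  have hval : ∀ t, ∫ ω, (((z (k, s) ω * z (k, t) ω) *
        ((M *ᵥ fun a => z a ω) (k, s) * (M *ᵥ fun a => z a ω) (k, t)) : ℝ) : ℂ) *
        g (eraseBlock k fun a => z a ω) ∂P = (if s = t then 1 else 0) *
      ∫ ω, (((M *ᵥ fun a => z a ω) (k, s) * (M *ᵥ fun a => z a ω) (k, t) : ℝ) : ℂ) *
        g (eraseBlock k fun a => z a ω) ∂P := by
    intro t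
    have h := hz.integral_comp_mul_comp k (f := fun x => ((x s * x t : ℝ) : ℂ))
      (g := fun x => (((M *ᵥ x) (k, s) * (M *ᵥ x) (k, t) : ℝ) : ℂ) * g x) (by fun_prop)
      ((Complex.measurable_ofReal.comp
        ((measurable_mulVec M _).mul (measurable_mulVec M _))).mul hg)
    simp_rw [mulVec_eraseBlock hM0] at h
    simp_rw [Complex.ofReal_mul (z (k, s) _ * z (k, t) _), mul_assoc]
    rw [h, integral_complex_ofReal, hz.moment_two]
    by_cases hst : s = t <;> simp [hst]
  simp_rw [hval]
  simp

lemma IsBlockNoise.integral_blockSq [IsFiniteMeasure P] (hz : IsBlockNoise P Δ z) (k : ι) :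
    ∫ ω, blockSq M k (fun a => z a ω) ∂P = blockEnergy M k := by
  simp_rw [blockSq_eq_quadForm]
  rw [hz.integral_quadForm, trace_blockGram]

lemma IsBlockNoise.integral_blockForm_sq [IsFiniteMeasure P] (hz : IsBlockNoise P Δ z)
    (hM0 : ∀ k s t, M (k, s) (k, t) = 0) (k : ι) :
    ∫ ω, blockForm M k (fun a => z a ω) ^ 2 ∂P = blockEnergy M k := by
  have h := hz.integral_blockForm_sq_mul hM0 k (g := fun _ => 1) measurable_const (by simp)
  simp only [mul_one] at h
  rw [integral_complex_ofReal, integral_complex_ofReal, hz.integral_blockSq] at h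
  exact_mod_cast h

lemma IsBlockNoise.integral_blockSq_sq_le (hz : IsBlockNoise P Δ z) (k : ι) :
    ∫ ω, blockSq M k (fun a => z a ω) ^ 2 ∂P ≤ (3 + |Δ|) * blockEnergy M k ^ 2 := by
  simp_rw [blockSq_eq_quadForm]
  refine (hz.integral_quadForm_sq_le (blockGram_symm M k)).trans ?_
  rw [trace_blockGram]
  nlinarith [mul_le_mul_of_nonneg_left (sum_blockGram_sq_le M k)
    (by positivity : (0 : ℝ) ≤ 2 + |Δ|)]

/-- `E T_k⁴ ≤ (3 + |Δ|) E q_k²`: given the other blocks, `T_k` is a linear form in block `k`. -/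
lemma IsBlockNoise.lintegral_blockForm_pow_four_le [IsFiniteMeasure P] (hz : IsBlockNoise P Δ z)
    (hM0 : ∀ k s t, M (k, s) (k, t) = 0) (k : ι) :
    ∫⁻ ω, ENNReal.ofReal (blockForm M k (fun a => z a ω) ^ 4) ∂P ≤
      ENNReal.ofReal ((3 + |Δ|) * ∫ ω, blockSq M k (fun a => z a ω) ^ 2 ∂P) := by
  have hX : Measurable fun ω s => z (k, s) ω := measurable_pi_lambda _ fun s => hz.measurable _
  have hzm : Measurable fun ω a => z a ω := measurable_pi_lambda _ hz.measurable
  have hR : Measurable fun ω => eraseBlock k fun a => z a ω := (measurable_eraseBlock k).comp hzm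
  set F : (κ → ℝ) × (ι × κ → ℝ) → ENNReal := fun y =>
    ENNReal.ofReal ((∑ s, y.1 s * (M *ᵥ y.2) (k, s)) ^ 4) with hF
  have hFm : Measurable F := by
    refine ENNReal.measurable_ofReal.comp ((Finset.measurable_sum _ fun s _ => ?_).pow_const 4)
    exact ((measurable_pi_apply s).comp measurable_fst).mul
      ((measurable_mulVec M _).comp measurable_snd)
  have hlin : ∀ v : κ → ℝ, Integrable (fun ω => (∑ s, z (k, s) ω * v s) ^ 4) P ∧
      ∫ ω, (∑ s, z (k, s) ω * v s) ^ 4 ∂P ≤ (3 + |Δ|) * (∑ s, v s ^ 2) ^ 2 := by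
    intro v
    constructor
    · have : MemLp (fun ω => ∑ s, z (k, s) ω * v s) 4 P :=
        memLp_finsetSum _ fun s _ => (hz.memLp_four (k, s)).mul_const _
      have h2 := integrable_mul_of_memLp_two (memLp_two_mul this this) (memLp_two_mul this this)
      refine h2.congr (Eventually.of_forall fun ω => ?_)
      simp only
      ring
    · have h := hz.integral_linear_pow_four_le (fun a => if a.1 = k then v a.2 else 0)
      have e1 : ∀ ω, ∑ a : ι × κ, (if a.1 = k then v a.2 else 0) * z a ω =
          ∑ s, z (k, s) ω * v s := by
        intro ω
        rw [Fintype.sum_prod_type, Finset.sum_eq_single k]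
        · simp [mul_comm]
        · intro l _ hl; simp [hl]
        · simp
      have e2 : ∑ a : ι × κ, (if a.1 = k then v a.2 else 0) ^ 2 = ∑ s, v s ^ 2 := by
        rw [Fintype.sum_prod_type, Finset.sum_eq_single k]
        · simp
        · intro l _ hl; simp [hl]
        · simp
      simp_rw [e1] at h
      rwa [e2] at h
  have hprod := (indepFun_iff_map_prod_eq_prod_map_map hX.aemeasurable hR.aemeasurable).1 (hz.indep k)
  calc ∫⁻ ω, ENNReal.ofReal (blockForm M k (fun a => z a ω) ^ 4) ∂P
      = ∫⁻ ω, F (fun s => z (k, s) ω, eraseBlock k fun a => z a ω) ∂P := by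
        simp only [hF, mulVec_eraseBlock hM0, blockForm]
    _ = ∫⁻ y, F y ∂(P.map fun ω => (fun s => z (k, s) ω, eraseBlock k fun a => z a ω)) :=
        (lintegral_map hFm (hX.prodMk hR)).symm
    _ = ∫⁻ r, ∫⁻ x, F (x, r) ∂(P.map fun ω s => z (k, s) ω)
          ∂(P.map fun ω => eraseBlock k fun a => z a ω) := by
        rw [hprod, lintegral_prod_symm' _ hFm]
    _ ≤ ∫⁻ r, ENNReal.ofReal ((3 + |Δ|) * (∑ s, (M *ᵥ r) (k, s) ^ 2) ^ 2)
          ∂(P.map fun ω => eraseBlock k fun a => z a ω) := by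
        refine lintegral_mono fun r => ?_
        rw [lintegral_map (f := fun x => F (x, r))
          (hFm.comp (measurable_id.prodMk measurable_const)) hX]
        simp only [hF]
        obtain ⟨hi, hle⟩ := hlin fun s => (M *ᵥ r) (k, s)
        rw [← ofReal_integral_eq_lintegral_ofReal hi
          (Eventually.of_forall fun ω => by positivity)]
        exact ENNReal.ofReal_le_ofReal hle
    _ = ∫⁻ ω, ENNReal.ofReal ((3 + |Δ|) * blockSq M k (fun a => z a ω) ^ 2) ∂P := by
        rw [lintegral_map _ hR]
        · simp only [mulVec_eraseBlock hM0, blockSq]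
        · exact ENNReal.measurable_ofReal.comp (((Finset.measurable_sum _ fun s _ =>
            (measurable_mulVec M _).pow_const 2).pow_const 2).const_mul _)
    _ = ENNReal.ofReal ((3 + |Δ|) * ∫ ω, blockSq M k (fun a => z a ω) ^ 2 ∂P) := by
        rw [← integral_const_mul, ofReal_integral_eq_lintegral_ofReal]
        · exact (hz.memLp_blockSq M k).integrable_sq.const_mul _
        · exact Eventually.of_forall fun ω => by positivity

lemma IsBlockNoise.integrable_blockForm_pow_four [IsFiniteMeasure P] (hz : IsBlockNoise P Δ z)
    (hM0 : ∀ k s t, M (k, s) (k, t) = 0) (k : ι) :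
    Integrable (fun ω => blockForm M k (fun a => z a ω) ^ 4) P := by
  refine ⟨((hz.memLp_blockForm M k).aestronglyMeasurable.pow 4), ?_⟩
  rw [hasFiniteIntegral_iff_ofReal (Eventually.of_forall fun ω => by positivity)]
  exact (hz.lintegral_blockForm_pow_four_le hM0 k).trans_lt ENNReal.ofReal_lt_top

lemma IsBlockNoise.integral_blockForm_pow_four_le [IsFiniteMeasure P] (hz : IsBlockNoise P Δ z)
    (hM0 : ∀ k s t, M (k, s) (k, t) = 0) (k : ι) :
    ∫ ω, blockForm M k (fun a => z a ω) ^ 4 ∂P ≤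
      (3 + |Δ|) * ∫ ω, blockSq M k (fun a => z a ω) ^ 2 ∂P := by
  rw [integral_eq_lintegral_of_nonneg_ae (Eventually.of_forall fun ω => by positivity)
    (hz.integrable_blockForm_pow_four hM0 k).aestronglyMeasurable]
  refine ENNReal.toReal_le_of_le_ofReal ?_ (hz.lintegral_blockForm_pow_four_le hM0 k)
  exact mul_nonneg (by positivity) (integral_nonneg fun ω => sq_nonneg _)

end BlockNoise

/-! ### The characteristic function of a block quadratic form -/

/-- Second-order Taylor bound with a non-optimal constant, valid for every real `x`. -/
lemma norm_cexp_sub_one_sub_le (x : ℝ) :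
    ‖Complex.exp (x * Complex.I) - 1 - x * Complex.I‖ ≤ 3 * x ^ 2 := by
  have hn : ‖(x : ℂ) * Complex.I‖ = |x| := by simp
  rcases le_total |x| 1 with h | h
  · have := Complex.norm_exp_sub_one_sub_id_le (x := x * Complex.I) (by rwa [hn])
    rw [hn, sq_abs] at this
    nlinarith [sq_nonneg x]
  · have h1 : ‖Complex.exp (x * Complex.I)‖ = 1 := Complex.norm_exp_ofReal_mul_I x
    calc _ ≤ ‖Complex.exp (x * Complex.I)‖ + ‖(1 : ℂ)‖ + ‖(x : ℂ) * Complex.I‖ :=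
          (norm_sub_le _ _).trans (add_le_add_left (norm_sub_le _ _) _)
      _ = 2 + |x| := by rw [h1, hn, norm_one]; ring
      _ ≤ 3 * x ^ 2 := by rw [← sq_abs]; nlinarith

lemma norm_cexp_sub_one_le (x : ℝ) : ‖Complex.exp (x * Complex.I) - 1‖ ≤ |x| := by
  have := Real.norm_exp_I_mul_ofReal_sub_one_le (x := x)
  rwa [mul_comm, Real.norm_eq_abs] at this

/-- A function that nearly solves `φ' = -s φ`, `φ 0 = 1`, is close to `exp (-s² / 2)`. -/
lemma norm_sub_exp_le_of_hasDerivAt {φ φ' : ℝ → ℂ} (hφ : ∀ s, HasDerivAt φ (φ' s) s)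
    (h0 : φ 0 = 1) {t c : ℝ} (hc : ∀ s, |s| ≤ |t| → ‖φ' s + s * φ s‖ ≤ c) :
    ‖φ t - Complex.exp (-(t ^ 2) / 2)‖ ≤ |t| * c := by
  -- Multiplying by the integrating factor `exp (s² / 2)` reduces to the mean value inequality.
  have hψ : ∀ s : ℝ, HasDerivAt (fun s : ℝ => φ s * Complex.exp ((s : ℂ) ^ 2 / 2))
      ((φ' s + s * φ s) * Complex.exp ((s : ℂ) ^ 2 / 2)) s := by
    intro s
    have h1 : HasDerivAt (fun s : ℝ => (s : ℂ) ^ 2 / 2) (s : ℂ) s := by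
      have := ((Complex.ofRealCLM.hasDerivAt (x := s)).pow 2).div_const 2
      simpa using this
    refine ((hφ s).mul h1.cexp).congr_deriv ?_
    ring
  have hnorm : ∀ s : ℝ, ‖Complex.exp ((s : ℂ) ^ 2 / 2)‖ = Real.exp (s ^ 2 / 2) := by
    intro s
    rw [← Complex.ofReal_pow, Complex.norm_exp]
    congr 1
    rw [show ((s ^ 2 : ℝ) : ℂ) / 2 = ((s ^ 2 / 2 : ℝ) : ℂ) by push_cast; ring, Complex.ofReal_re]
  have hbound := (convex_uIcc (0 : ℝ) t).norm_image_sub_le_of_norm_hasDerivWithin_le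
    (f := fun s : ℝ => φ s * Complex.exp ((s : ℂ) ^ 2 / 2)) (C := c * Real.exp (t ^ 2 / 2))
    (fun s _ => (hψ s).hasDerivWithinAt) (fun s hs => ?_) Set.left_mem_uIcc Set.right_mem_uIcc
  · have hfac : φ t - Complex.exp (-(t ^ 2) / 2) =
        (φ t * Complex.exp ((t : ℂ) ^ 2 / 2) - φ 0 * Complex.exp (((0 : ℝ) : ℂ) ^ 2 / 2)) *
          Complex.exp (-(t ^ 2) / 2) := by
      rw [h0, sub_mul, mul_assoc, ← Complex.exp_add]
      simp [← add_div]
    have hneg : ‖Complex.exp (-((t : ℂ) ^ 2) / 2)‖ = Real.exp (-(t ^ 2 / 2)) := by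
      rw [neg_div, Complex.exp_neg, norm_inv, hnorm, Real.exp_neg]
    rw [hfac, norm_mul, hneg]
    calc _ ≤ c * Real.exp (t ^ 2 / 2) * ‖t - 0‖ * Real.exp (-(t ^ 2 / 2)) :=
          mul_le_mul_of_nonneg_right hbound (Real.exp_pos _).le
      _ = |t| * c := by
          rw [sub_zero, Real.norm_eq_abs, Real.exp_neg]
          field_simp
  · have hst : |s| ≤ |t| := by
      have := Set.abs_sub_left_of_mem_uIcc hs
      simpa using this
    rw [norm_mul, hnorm]
    have hc0 : 0 ≤ c := (norm_nonneg _).trans (hc s hst)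
    refine mul_le_mul (hc s hst) (Real.exp_le_exp.2 ?_) (Real.exp_pos _).le hc0
    have := sq_le_sq.2 hst
    linarith

section CharFun

variable {Ω : Type*} [MeasurableSpace Ω] {P : Measure Ω} [IsProbabilityMeasure P]
variable {ι κ : Type*} [Fintype ι] [DecidableEq ι] [Fintype κ] [DecidableEq κ]
variable {Δ : ℝ} {z : ι × κ → Ω → ℝ} {M : Matrix (ι × κ) (ι × κ) ℝ}

/-- The character `x ↦ exp (i t T(x))` of `T(x) = xᵀ M x / 2`. -/
noncomputable def halfFormChar (M : Matrix (ι × κ) (ι × κ) ℝ) (t : ℝ) (x : ι × κ → ℝ) : ℂ :=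
  Complex.exp (((t * (quadForm M x / 2) : ℝ) : ℂ) * Complex.I)

omit [DecidableEq ι] [DecidableEq κ] in
lemma norm_halfFormChar (M : Matrix (ι × κ) (ι × κ) ℝ) (t : ℝ) (x : ι × κ → ℝ) :
    ‖halfFormChar M t x‖ = 1 :=
  Complex.norm_exp_ofReal_mul_I _

omit [DecidableEq ι] [DecidableEq κ] in
lemma measurable_halfFormChar (M : Matrix (ι × κ) (ι × κ) ℝ) (t : ℝ) :
    Measurable (halfFormChar M t) := by
  have := measurable_quadForm M
  unfold halfFormChar
  fun_prop

omit [DecidableEq κ] in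
lemma halfFormChar_eq_eraseBlock (hM : ∀ a b, M a b = M b a)
    (hM0 : ∀ k s t, M (k, s) (k, t) = 0) (t : ℝ) (k : ι) (x : ι × κ → ℝ) :
    halfFormChar M t x = halfFormChar M t (eraseBlock k x) *
      Complex.exp (((t * blockForm M k x : ℝ) : ℂ) * Complex.I) := by
  unfold halfFormChar
  rw [quadForm_eq_eraseBlock hM hM0 k x, ← Complex.exp_add]
  congr 1
  push_cast
  ring

/-- Stein-type identity with error term: `E (T_k e^{itT}) ≈ i t E (q_k e^{itT})`. -/
lemma IsBlockNoise.norm_integral_blockForm_sub_le (hz : IsBlockNoise P Δ z)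
    (hM : ∀ a b, M a b = M b a) (hM0 : ∀ k s t, M (k, s) (k, t) = 0) {η : ℝ} (hη : 0 < η) (k : ι)
    (hk : blockEnergy M k ≤ η ^ 2) (t : ℝ) :
    ‖∫ ω, (blockForm M k (fun a => z a ω) : ℂ) * halfFormChar M t (fun a => z a ω) ∂P -
        t * Complex.I *
          ∫ ω, (blockSq M k (fun a => z a ω) : ℂ) * halfFormChar M t (fun a => z a ω) ∂P‖ ≤
      t ^ 2 * ((2 + 2 * (3 + |Δ|) ^ 2) * η) * blockEnergy M k := by
  set A : Ω → ℝ := fun ω => blockForm M k fun a => z a ω with hA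
  set q : Ω → ℝ := fun ω => blockSq M k fun a => z a ω with hq
  set e : Ω → ℂ := fun ω => halfFormChar M t fun a => z a ω with he
  set e' : Ω → ℂ := fun ω => halfFormChar M t (eraseBlock k fun a => z a ω) with he'
  have hzm : Measurable fun ω a => z a ω := measurable_pi_lambda _ hz.measurable
  have hem : AEStronglyMeasurable e P :=
    ((measurable_halfFormChar M t).comp hzm).aestronglyMeasurable
  have hem' : AEStronglyMeasurable e' P :=
    ((measurable_halfFormChar M t).comp
      ((measurable_eraseBlock k).comp hzm)).aestronglyMeasurable
  have he1 : ∀ ω, ‖e ω‖ = 1 := fun ω => norm_halfFormChar _ _ _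
  have he1' : ∀ ω, ‖e' ω‖ = 1 := fun ω => norm_halfFormChar _ _ _
  have hA2 : MemLp A 2 P := hz.memLp_blockForm M k
  have hq2 : MemLp q 2 P := hz.memLp_blockSq M k
  have hA4 : Integrable (fun ω => A ω ^ 4) P := hz.integrable_blockForm_pow_four hM0 k
  have hAi := hA2.integrable one_le_two
  have hqi := hq2.integrable one_le_two
  have i1 : Integrable (fun ω => (A ω : ℂ) * e ω) P :=
    integrable_mul_unit hAi hem fun ω => (he1 ω).le
  have i2 : Integrable (fun ω => (t * Complex.I) * ((q ω : ℂ) * e ω)) P :=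
    (integrable_mul_unit hqi hem fun ω => (he1 ω).le).const_mul _
  have i3 : Integrable (fun ω => (A ω : ℂ) * e' ω) P :=
    integrable_mul_unit hAi hem' fun ω => (he1' ω).le
  have i4 : Integrable (fun ω => (t * Complex.I) * (((A ω ^ 2 : ℝ) : ℂ) * e' ω)) P :=
    (integrable_mul_unit hA2.integrable_sq hem' fun ω => (he1' ω).le).const_mul _
  have i5 : Integrable (fun ω => (t * Complex.I) * ((q ω : ℂ) * e' ω)) P :=
    (integrable_mul_unit hqi hem' fun ω => (he1' ω).le).const_mul _
  have z3 : ∫ ω, (A ω : ℂ) * e' ω ∂P = 0 :=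
    hz.integral_blockForm_mul hM0 k (measurable_halfFormChar M t)
      fun x => (norm_halfFormChar M t x).le
  have z45 : ∫ ω, ((A ω ^ 2 : ℝ) : ℂ) * e' ω ∂P = ∫ ω, (q ω : ℂ) * e' ω ∂P :=
    hz.integral_blockForm_sq_mul hM0 k (measurable_halfFormChar M t)
      fun x => (norm_halfFormChar M t x).le
  -- Subtracting the terms with `e'` changes nothing: the first one integrates to zero and the two
  -- second-order ones cancel.
  have hint : ∫ ω, (A ω : ℂ) * e ω ∂P - t * Complex.I * ∫ ω, (q ω : ℂ) * e ω ∂P =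
      ∫ ω, (((A ω : ℂ) * e ω - (t * Complex.I) * ((q ω : ℂ) * e ω)) - ((A ω : ℂ) * e' ω +
        ((t * Complex.I) * (((A ω ^ 2 : ℝ) : ℂ) * e' ω) -
          (t * Complex.I) * ((q ω : ℂ) * e' ω)))) ∂P := by
    have j1 : Integrable (fun ω => (A ω : ℂ) * e ω - (t * Complex.I) * ((q ω : ℂ) * e ω)) P :=
      i1.sub i2
    have j2 : Integrable (fun ω => (t * Complex.I) * (((A ω ^ 2 : ℝ) : ℂ) * e' ω) -
        (t * Complex.I) * ((q ω : ℂ) * e' ω)) P := i4.sub i5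
    have j3 : Integrable (fun ω => (A ω : ℂ) * e' ω + ((t * Complex.I) *
        (((A ω ^ 2 : ℝ) : ℂ) * e' ω) - (t * Complex.I) * ((q ω : ℂ) * e' ω))) P := i3.add j2
    rw [integral_sub j1 j3, integral_sub i1 i2, integral_add i3 j2, integral_sub i4 i5, z3, integral_const_mul, integral_const_mul,
      integral_const_mul, z45]
    simp
  have hpt : ∀ ω, ‖((A ω : ℂ) * e ω - (t * Complex.I) * ((q ω : ℂ) * e ω)) - ((A ω : ℂ) * e' ω +
        ((t * Complex.I) * (((A ω ^ 2 : ℝ) : ℂ) * e' ω) -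
          (t * Complex.I) * ((q ω : ℂ) * e' ω)))‖ ≤
      t ^ 2 * (2 * η * A ω ^ 2 + 3 / (2 * η) * A ω ^ 4 + 1 / (2 * η) * q ω ^ 2) := by
    intro ω
    have hq0 : 0 ≤ q ω := blockSq_nonneg _ _ _
    set u := Complex.exp (((t * A ω : ℝ) : ℂ) * Complex.I) with hu
    have hee : e ω = e' ω * u := halfFormChar_eq_eraseBlock hM hM0 t k _
    have hfac : ((A ω : ℂ) * e ω - (t * Complex.I) * ((q ω : ℂ) * e ω)) - ((A ω : ℂ) * e' ω +
        ((t * Complex.I) * (((A ω ^ 2 : ℝ) : ℂ) * e' ω) -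
          (t * Complex.I) * ((q ω : ℂ) * e' ω))) =
        e' ω * ((A ω : ℂ) * (u - 1 - ((t * A ω : ℝ) : ℂ) * Complex.I) -
          (t * Complex.I) * ((q ω : ℂ) * (u - 1))) := by
      rw [hee]
      push_cast
      ring
    have hu2 := norm_cexp_sub_one_sub_le (t * A ω)
    have hu1 := norm_cexp_sub_one_le (t * A ω)
    rw [← hu] at hu1 hu2
    rw [hfac, norm_mul, he1', one_mul]
    refine (norm_sub_le _ _).trans ?_
    rw [norm_mul, norm_mul, norm_mul, norm_mul, Complex.norm_real, Complex.norm_real,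
      Complex.norm_real, Complex.norm_I, Real.norm_eq_abs, Real.norm_eq_abs, Real.norm_eq_abs,
      abs_of_nonneg hq0, mul_one]
    have hb1 : |A ω| * ‖u - 1 - ((t * A ω : ℝ) : ℂ) * Complex.I‖ ≤ |A ω| * (3 * (t * A ω) ^ 2) :=
      mul_le_mul_of_nonneg_left hu2 (abs_nonneg _)
    have hb2 : |t| * (q ω * ‖u - 1‖) ≤ |t| * (q ω * |t * A ω|) := by gcongr
    -- the inequality `2 x y ≤ η x² + y² / η` with `x = |A|` and `y = A²` or `y = q`
    have y1 : |A ω| * A ω ^ 2 ≤ η / 2 * A ω ^ 2 + 1 / (2 * η) * A ω ^ 4 := by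
      have : 0 ≤ 1 / (2 * η) * (η * |A ω| - A ω ^ 2) ^ 2 := by positivity
      have e : 1 / (2 * η) * (η * |A ω| - A ω ^ 2) ^ 2 =
          η / 2 * |A ω| ^ 2 - |A ω| * A ω ^ 2 + 1 / (2 * η) * A ω ^ 4 := by
        field_simp; ring
      rw [e, sq_abs] at this
      linarith
    have y2 : q ω * |A ω| ≤ η / 2 * A ω ^ 2 + 1 / (2 * η) * q ω ^ 2 := by
      have : 0 ≤ 1 / (2 * η) * (η * |A ω| - q ω) ^ 2 := by positivity
      have e : 1 / (2 * η) * (η * |A ω| - q ω) ^ 2 =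
          η / 2 * |A ω| ^ 2 - q ω * |A ω| + 1 / (2 * η) * q ω ^ 2 := by
        field_simp; ring
      rw [e, sq_abs] at this
      linarith
    have ht2 : |t| * (q ω * |t * A ω|) = t ^ 2 * (q ω * |A ω|) := by
      rw [abs_mul, ← sq_abs t]; ring
    have ht3 : |A ω| * (3 * (t * A ω) ^ 2) = t ^ 2 * (3 * (|A ω| * A ω ^ 2)) := by ring
    calc _ ≤ t ^ 2 * (3 * (|A ω| * A ω ^ 2)) + t ^ 2 * (q ω * |A ω|) := by
          rw [← ht2, ← ht3]; exact add_le_add hb1 hb2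
      _ ≤ t ^ 2 * (3 * (η / 2 * A ω ^ 2 + 1 / (2 * η) * A ω ^ 4)) +
          t ^ 2 * (η / 2 * A ω ^ 2 + 1 / (2 * η) * q ω ^ 2) := by gcongr
      _ = _ := by field_simp; ring
  have b1 : Integrable (fun ω => 2 * η * A ω ^ 2) P := hA2.integrable_sq.const_mul _
  have b2 : Integrable (fun ω => 3 / (2 * η) * A ω ^ 4) P := hA4.const_mul _
  have b3 : Integrable (fun ω => 1 / (2 * η) * q ω ^ 2) P := hq2.integrable_sq.const_mul _
  have b12 : Integrable (fun ω => 2 * η * A ω ^ 2 + 3 / (2 * η) * A ω ^ 4) P := b1.add b2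
  have hEA2 : ∫ ω, A ω ^ 2 ∂P = blockEnergy M k := hz.integral_blockForm_sq hM0 k
  have hEq2 : ∫ ω, q ω ^ 2 ∂P ≤ (3 + |Δ|) * blockEnergy M k ^ 2 := hz.integral_blockSq_sq_le k
  have hEA4 : ∫ ω, A ω ^ 4 ∂P ≤ (3 + |Δ|) * ∫ ω, q ω ^ 2 ∂P :=
    hz.integral_blockForm_pow_four_le hM0 k
  rw [hint]
  refine (norm_integral_le_of_norm_le ((b12.add b3).const_mul _) (Eventually.of_forall hpt)).trans ?_
  rw [integral_const_mul, integral_add' b12 b3, integral_add b1 b2, integral_const_mul,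
    integral_const_mul, integral_const_mul, hEA2,
    mul_assoc (t ^ 2)]
  refine mul_le_mul_of_nonneg_left ?_ (sq_nonneg t)
  set C := 3 + |Δ| with hC
  have hC1 : 1 ≤ C := by have := abs_nonneg Δ; linarith
  have hC0 : 0 ≤ C := by linarith
  set h := blockEnergy M k with hh
  have hh0 : 0 ≤ h := blockEnergy_nonneg M k
  have hhη : h ^ 2 ≤ η ^ 2 * h := by nlinarith
  have hEq2' : ∫ ω, q ω ^ 2 ∂P ≤ C * (η ^ 2 * h) := hEq2.trans (by gcongr)
  have hEA4' : ∫ ω, A ω ^ 4 ∂P ≤ C * (C * (η ^ 2 * h)) := hEA4.trans (by gcongr)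
  have hCC : C ≤ C ^ 2 := by nlinarith
  calc _ ≤ 2 * η * h + 3 / (2 * η) * (C * (C * (η ^ 2 * h))) + 1 / (2 * η) * (C * (η ^ 2 * h)) := by
        gcongr
    _ = 2 * η * h + (3 / 2 * C ^ 2 + 1 / 2 * C) * (η * h) := by
      field_simp
      ring
    _ ≤ 2 * η * h + (2 * C ^ 2) * (η * h) := by gcongr; linarith
    _ = _ := by ring

/-- The characteristic function of `T = zᵀ M z / 2`. -/
noncomputable def halfFormCharFun (P : Measure Ω) (z : ι × κ → Ω → ℝ)
    (M : Matrix (ι × κ) (ι × κ) ℝ) (t : ℝ) : ℂ :=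
  ∫ ω, halfFormChar M t (fun a => z a ω) ∂P

lemma IsBlockNoise.hasDerivAt_halfFormCharFun (hz : IsBlockNoise P Δ z) (t : ℝ) :
    HasDerivAt (halfFormCharFun P z M) (∫ ω, ((quadForm M (fun a => z a ω) / 2 : ℝ) : ℂ) *
      halfFormChar M t (fun a => z a ω) * Complex.I ∂P) t := by
  have hzm : Measurable fun ω a => z a ω := measurable_pi_lambda _ hz.measurable
  have hT : Integrable (fun ω => quadForm M (fun a => z a ω) / 2) P :=
    ((hz.memLp_quadForm M).integrable one_le_two).div_const 2
  have hem : ∀ s, AEStronglyMeasurable (fun ω => halfFormChar M s fun a => z a ω) P := fun s =>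
    ((measurable_halfFormChar M s).comp hzm).aestronglyMeasurable
  refine (hasDerivAt_integral_of_dominated_loc_of_deriv_le (Metric.ball_mem_nhds t one_pos)
    (F := fun s ω => halfFormChar M s fun a => z a ω)
    (bound := fun ω => |quadForm M (fun a => z a ω) / 2|)
    (F' := fun s ω => ((quadForm M (fun a => z a ω) / 2 : ℝ) : ℂ) *
      halfFormChar M s (fun a => z a ω) * Complex.I)
    (Eventually.of_forall hem) ?_ ?_ ?_ hT.abs ?_).2
  · exact (integrable_const (1 : ℝ)).mono' (hem t)
      (Eventually.of_forall fun ω => (norm_halfFormChar _ _ _).le)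
  · exact (integrable_mul_unit hT (hem t) fun ω => (norm_halfFormChar _ _ _).le).1.mul_const _
  · refine Eventually.of_forall fun ω s _ => ?_
    rw [norm_mul, norm_mul, norm_halfFormChar, Complex.norm_I, Complex.norm_real, mul_one, mul_one,
      Real.norm_eq_abs]
  · refine Eventually.of_forall fun ω s _ => ?_
    have h1 : HasDerivAt (fun s : ℝ => ((s * (quadForm M (fun a => z a ω) / 2) : ℝ) : ℂ))
        ((quadForm M (fun a => z a ω) / 2 : ℝ) : ℂ) s := by
      have := ((hasDerivAt_id s).mul_const (quadForm M (fun a => z a ω) / 2)).ofReal_comp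
      simpa using this
    refine (h1.mul_const Complex.I).cexp.congr_deriv ?_
    simp only [halfFormChar]
    ring

/-- Up to the errors governed by `η` and `ρ`, the characteristic function satisfies
`φ' = -t φ`. -/
lemma IsBlockNoise.norm_deriv_halfFormCharFun_add_le (hz : IsBlockNoise P Δ z)
    (hM : ∀ a b, M a b = M b a) (hM0 : ∀ k s t, M (k, s) (k, t) = 0)
    (hM2 : ∑ a, ∑ b, M a b ^ 2 = 2) {η ρ : ℝ} (hη : 0 < η) (hρ : 0 < ρ)
    (hk : ∀ k, blockEnergy M k ≤ η ^ 2) (hM4 : ∑ a, ∑ b, (M * M) a b ^ 2 ≤ ρ ^ 2) (t : ℝ) :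
    ‖∫ ω, ((quadForm M (fun a => z a ω) / 2 : ℝ) : ℂ) *
      halfFormChar M t (fun a => z a ω) * Complex.I ∂P + t * halfFormCharFun P z M t‖ ≤
      t ^ 2 * ((2 + 2 * (3 + |Δ|) ^ 2) * η) + |t| * ((3 + |Δ|) * ρ) := by
  set e : Ω → ℂ := fun ω => halfFormChar M t fun a => z a ω with he
  have hzm : Measurable fun ω a => z a ω := measurable_pi_lambda _ hz.measurable
  have hem : AEStronglyMeasurable e P :=
    ((measurable_halfFormChar M t).comp hzm).aestronglyMeasurable
  have he1 : ∀ ω, ‖e ω‖ = 1 := fun ω => norm_halfFormChar _ _ _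
  -- `V` is half the sum of the conditional variances `q_k`, and `E V = 1`.
  set V : Ω → ℝ := fun ω => quadForm (M * M) (fun a => z a ω) / 2 with hV
  have hVm : MemLp V 2 P := by
    have := (hz.memLp_quadForm (M * M)).const_mul (1 / 2)
    refine this.ae_eq (Eventually.of_forall fun ω => ?_)
    simp only [hV]; ring
  have hVi := hVm.integrable one_le_two
  have hiA : ∀ k, Integrable (fun ω => (blockForm M k (fun a => z a ω) : ℂ) * e ω) P := fun k =>
    integrable_mul_unit ((hz.memLp_blockForm M k).integrable one_le_two) hem fun ω => (he1 ω).le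
  have hiq : ∀ k, Integrable (fun ω => (blockSq M k (fun a => z a ω) : ℂ) * e ω) P := fun k =>
    integrable_mul_unit ((hz.memLp_blockSq M k).integrable one_le_two) hem fun ω => (he1 ω).le
  have hsumA : ∫ ω, ((quadForm M (fun a => z a ω) / 2 : ℝ) : ℂ) * e ω * Complex.I ∂P =
      Complex.I / 2 * ∑ k, ∫ ω, (blockForm M k (fun a => z a ω) : ℂ) * e ω ∂P := by
    rw [← integral_finsetSum _ fun k _ => hiA k, ← integral_const_mul]
    refine integral_congr_ae (Eventually.of_forall fun ω => ?_)
    simp only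
    rw [← sum_blockForm, ← Finset.sum_mul]
    push_cast
    ring
  have hsumq : ∫ ω, (V ω : ℂ) * e ω ∂P =
      1 / 2 * ∑ k, ∫ ω, (blockSq M k (fun a => z a ω) : ℂ) * e ω ∂P := by
    rw [← integral_finsetSum _ fun k _ => hiq k, ← integral_const_mul]
    refine integral_congr_ae (Eventually.of_forall fun ω => ?_)
    simp only [hV]
    rw [← sum_blockSq hM, ← Finset.sum_mul]
    push_cast
    ring
  have hei : Integrable e P := (integrable_const (1 : ℝ)).mono' hem
    (Eventually.of_forall fun ω => (he1 ω).le)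
  have hVe : Integrable (fun ω => (V ω : ℂ) * e ω) P :=
    integrable_mul_unit hVi hem fun ω => (he1 ω).le
  have hV1 : ∫ ω, ((1 - V ω : ℝ) : ℂ) * e ω ∂P = ∫ ω, e ω ∂P - ∫ ω, (V ω : ℂ) * e ω ∂P := by
    rw [← integral_sub hei hVe]
    refine integral_congr_ae (Eventually.of_forall fun ω => ?_)
    simp only
    push_cast
    ring
  have hdec : ∫ ω, ((quadForm M (fun a => z a ω) / 2 : ℝ) : ℂ) * e ω * Complex.I ∂P +
      t * halfFormCharFun P z M t =
      Complex.I / 2 * ∑ k, (∫ ω, (blockForm M k (fun a => z a ω) : ℂ) * e ω ∂P -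
        t * Complex.I * ∫ ω, (blockSq M k (fun a => z a ω) : ℂ) * e ω ∂P) +
      t * ∫ ω, ((1 - V ω : ℝ) : ℂ) * e ω ∂P := by
    rw [hsumA, hV1, hsumq, Finset.sum_sub_distrib, ← Finset.mul_sum]
    change _ + t * ∫ ω, e ω ∂P = _
    linear_combination ((t : ℂ) / 2 * ∑ k, ∫ ω, (blockSq M k (fun a => z a ω) : ℂ) * e ω ∂P) *
      Complex.I_sq
  rw [hdec]
  have hfirst : ‖Complex.I / 2 * ∑ k, (∫ ω, (blockForm M k (fun a => z a ω) : ℂ) * e ω ∂P -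
        t * Complex.I * ∫ ω, (blockSq M k (fun a => z a ω) : ℂ) * e ω ∂P)‖ ≤
      t ^ 2 * ((2 + 2 * (3 + |Δ|) ^ 2) * η) := by
    rw [norm_mul, norm_div, Complex.norm_I, Complex.norm_two]
    have h1 := (norm_sum_le Finset.univ fun k =>
      (∫ ω, (blockForm M k (fun a => z a ω) : ℂ) * e ω ∂P -
        t * Complex.I * ∫ ω, (blockSq M k (fun a => z a ω) : ℂ) * e ω ∂P)).trans
      (Finset.sum_le_sum fun k _ => hz.norm_integral_blockForm_sub_le hM hM0 hη k (hk k) t)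
    rw [← Finset.mul_sum, sum_blockEnergy, hM2] at h1
    linarith
  have htrace : (M * M).trace = 2 := by
    rw [← hM2]
    simp only [Matrix.trace, Matrix.diag, Matrix.mul_apply]
    exact Finset.sum_congr rfl fun a _ => Finset.sum_congr rfl fun b _ => by rw [hM b a]; ring
  have hMMs : ∀ a b, (M * M) a b = (M * M) b a := fun a b => by
    simp only [Matrix.mul_apply]
    exact Finset.sum_congr rfl fun c _ => by rw [hM a c, hM c b]; ring
  have hvar : ∫ ω, (1 - V ω) ^ 2 ∂P ≤ (2 + |Δ|) / 4 * ρ ^ 2 := by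
    have h1 := hz.integral_quadForm_sub_trace_sq_le hMMs
    have h2 : ∀ ω, (1 - V ω) ^ 2 =
        1 / 4 * (quadForm (M * M) (fun a => z a ω) - (M * M).trace) ^ 2 := fun ω => by
      simp only [hV, htrace]; ring
    simp_rw [h2]
    rw [integral_const_mul]
    have := mul_le_mul_of_nonneg_left hM4 (by positivity : (0 : ℝ) ≤ 2 + |Δ|)
    linarith
  have hsecond : ‖∫ ω, ((1 - V ω : ℝ) : ℂ) * e ω ∂P‖ ≤ (3 + |Δ|) * ρ := by
    have hsq : Integrable (fun ω => (1 - V ω) ^ 2) P := ((memLp_const 1).sub hVm).integrable_sq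
    -- `|y| ≤ ρ / 2 + y² / (2 ρ)` with `y = 1 - V`
    have hb : ∀ ω, ‖((1 - V ω : ℝ) : ℂ) * e ω‖ ≤ ρ / 2 + 1 / (2 * ρ) * (1 - V ω) ^ 2 := by
      intro ω
      rw [norm_mul, he1, mul_one, Complex.norm_real, Real.norm_eq_abs]
      have : 0 ≤ 1 / (2 * ρ) * (ρ - |1 - V ω|) ^ 2 := by positivity
      have e : 1 / (2 * ρ) * (ρ - |1 - V ω|) ^ 2 =
          ρ / 2 - |1 - V ω| + 1 / (2 * ρ) * |1 - V ω| ^ 2 := by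
        field_simp; ring
      rw [e, sq_abs] at this
      linarith
    refine (norm_integral_le_of_norm_le ((integrable_const _).add (hsq.const_mul _))
      (Eventually.of_forall hb)).trans ?_
    rw [integral_add' (integrable_const _) (hsq.const_mul _), integral_const_mul]
    simp only [integral_const, probReal_univ, one_smul]
    calc _ ≤ ρ / 2 + 1 / (2 * ρ) * ((2 + |Δ|) / 4 * ρ ^ 2) := by gcongr
      _ = (1 / 2 + (2 + |Δ|) / 8) * ρ := by field_simp; ring
      _ ≤ (3 + |Δ|) * ρ := by
        have := abs_nonneg Δ
        exact mul_le_mul_of_nonneg_right (by linarith) hρ.le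
  refine (norm_add_le _ _).trans (add_le_add hfirst ?_)
  rw [norm_mul, Complex.norm_real, Real.norm_eq_abs]
  exact mul_le_mul_of_nonneg_left hsecond (abs_nonneg t)

/-- Quantitative normal approximation for a quadratic form of unit variance whose diagonal blocks
vanish. -/
theorem IsBlockNoise.norm_halfFormCharFun_sub_le (hz : IsBlockNoise P Δ z)
    (hM : ∀ a b, M a b = M b a) (hM0 : ∀ k s t, M (k, s) (k, t) = 0)
    (hM2 : ∑ a, ∑ b, M a b ^ 2 = 2) {η ρ : ℝ} (hη : 0 < η) (hρ : 0 < ρ)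
    (hk : ∀ k, blockEnergy M k ≤ η ^ 2) (hM4 : ∑ a, ∑ b, (M * M) a b ^ 2 ≤ ρ ^ 2) (t : ℝ) :
    ‖halfFormCharFun P z M t - Complex.exp (-(t ^ 2) / 2)‖ ≤
      |t| * (t ^ 2 * ((2 + 2 * (3 + |Δ|) ^ 2) * η) + |t| * ((3 + |Δ|) * ρ)) := by
  refine norm_sub_exp_le_of_hasDerivAt (fun s => hz.hasDerivAt_halfFormCharFun s) ?_ fun s hs => ?_
  · simp [halfFormCharFun, halfFormChar]
  · refine (hz.norm_deriv_halfFormCharFun_add_le hM hM0 hM2 hη hρ hk hM4 s).trans ?_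
    have := sq_le_sq.2 hs
    gcongr

end CharFun

/-! ### Fourth-order energy of a block matrix -/

/-- A bound on `‖M²‖` from bounds on the products of two blocks of `M` (Frobenius norms). -/
lemma sum_mul_self_sq_le {ι κ : Type*} [Fintype ι] [Fintype κ] {M : Matrix (ι × κ) (ι × κ) ℝ}
    {ε : ℝ} (hε : 0 ≤ ε)
    (h : ∀ k l l', ∑ s, ∑ t, (∑ u, M (k, s) (l, u) * M (l, u) (l', t)) ^ 2 ≤
      ε * ((∑ s, ∑ t, M (k, s) (l, t) ^ 2) * ∑ s, ∑ t, M (l, s) (l', t) ^ 2)) :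
    ∑ a, ∑ b, (M * M) a b ^ 2 ≤ ε * (∑ a, ∑ b, M a b ^ 2) ^ 2 := by
  set f : ι → ι → ℝ := fun k l => ∑ s, ∑ t, M (k, s) (l, t) ^ 2 with hf
  set x : ι → ι → ι → κ → κ → ℝ := fun k l l' s t => ∑ u, M (k, s) (l, u) * M (l, u) (l', t) with hx
  have hf0 : ∀ k l, 0 ≤ f k l := fun k l =>
    Finset.sum_nonneg fun _ _ => Finset.sum_nonneg fun _ _ => sq_nonneg _
  have hfx : ∀ k l l' s t, f k l = 0 → x k l l' s t = 0 := by
    intro k l l' s t h0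
    refine Finset.sum_eq_zero fun u _ => ?_
    have h1 := (Finset.sum_eq_zero_iff_of_nonneg fun s _ =>
      Finset.sum_nonneg fun t _ => sq_nonneg (M (k, s) (l, t))).1 h0 s (Finset.mem_univ s)
    have h2 := (Finset.sum_eq_zero_iff_of_nonneg fun t _ => sq_nonneg (M (k, s) (l, t))).1 h1 u
      (Finset.mem_univ u)
    rw [pow_eq_zero_iff two_ne_zero] at h2
    rw [h2, zero_mul]
  have hblock : ∀ k l', ∑ s, ∑ t, (∑ l, x k l l' s t) ^ 2 ≤ (∑ l, f k l) * ∑ l, ε * f l l' := by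
    intro k l'
    -- Cauchy-Schwarz with the weights `f k l`; terms with `f k l = 0` vanish, so that the junk value
    -- of the division is harmless.
    have hcs : ∀ s t, (∑ l, x k l l' s t) ^ 2 ≤ (∑ l, f k l) * ∑ l, x k l l' s t ^ 2 / f k l := by
      intro s t
      refine Finset.sum_sq_le_sum_mul_sum_of_sq_le_mul _ (fun l _ => hf0 k l)
        (fun l _ => div_nonneg (sq_nonneg _) (hf0 k l)) fun l _ => le_of_eq ?_
      by_cases h0 : f k l = 0
      · simp [hfx k l l' s t h0]
      · field_simp
    refine (Finset.sum_le_sum fun s _ => Finset.sum_le_sum fun t _ => hcs s t).trans ?_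
    simp_rw [← Finset.mul_sum]
    refine mul_le_mul_of_nonneg_left ?_ (Finset.sum_nonneg fun l _ => hf0 k l)
    have hswap : ∑ s, ∑ t, ∑ l, x k l l' s t ^ 2 / f k l =
        ∑ l, (∑ s, ∑ t, x k l l' s t ^ 2) / f k l := by
      simp_rw [Finset.sum_div]
      exact (Finset.sum_congr rfl fun s _ => Finset.sum_comm).trans Finset.sum_comm
    rw [hswap, Finset.mul_sum]
    refine Finset.sum_le_sum fun l _ => ?_
    by_cases h0 : f k l = 0
    · rw [h0, div_zero]
      exact mul_nonneg hε (hf0 l l')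
    · have hpos : 0 < f k l := lt_of_le_of_ne (hf0 k l) (Ne.symm h0)
      rw [div_le_iff₀ hpos]
      refine (h k l l').trans_eq ?_
      ring
  have hF : ∑ a, ∑ b, M a b ^ 2 = ∑ k, ∑ l, f k l := by
    simp_rw [Fintype.sum_prod_type, hf]
    exact Finset.sum_congr rfl fun k _ => Finset.sum_comm
  have hFF : ∑ a, ∑ b, (M * M) a b ^ 2 = ∑ k, ∑ l', ∑ s, ∑ t, (∑ l, x k l l' s t) ^ 2 := by
    simp_rw [Matrix.mul_apply, Fintype.sum_prod_type, hx]
    exact Finset.sum_congr rfl fun k _ => Finset.sum_comm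
  rw [hFF, hF]
  refine (Finset.sum_le_sum fun k _ => Finset.sum_le_sum fun l' _ => hblock k l').trans_eq ?_
  rw [← Finset.sum_mul_sum]
  simp_rw [← Finset.mul_sum]
  rw [Finset.sum_comm (f := fun l' l => f l l')]
  ring

/-! ### The components of the factor model form block noise -/

section Model

variable {K p m : ℕ} {n : Fin K → ℕ} {Ω : Type*} [MeasurableSpace Ω] {P : Measure Ω}
  [IsProbabilityMeasure P]
  {μ : Fin K → Fin p → ℝ} {S : Fin K → Matrix (Fin p) (Fin p) ℝ}
  {Γ : Fin K → Matrix (Fin p) (Fin m) ℝ} {Z : (α : Fin K) → Fin (n α) → Ω → Fin m → ℝ}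
  {Y : (α : Fin K) → Fin (n α) → Ω → Fin p → ℝ} {Δ : ℝ}

/-- The components of all the vectors `Z_{αi}`, indexed by the observation and the coordinate. -/
def components (Z : (α : Fin K) → Fin (n α) → Ω → Fin m → ℝ)
    (a : ((α : Fin K) × Fin (n α)) × Fin m) (ω : Ω) : ℝ := Z a.1.1 a.1.2 ω a.2

/-- The factorization hypothesis for exponents that may vanish: it is applied to the support of
`e`. -/
lemma PseudoIndependent.integral_prod_pow (hZ : PseudoIndependent P Δ Z) (α : Fin K)
    (i : Fin (n α)) {e : Fin m → ℕ} (he : ∑ s, e s ≤ 8) :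
    ∫ ω, ∏ s, Z α i ω s ^ e s ∂P = ∏ s, ∫ ω, Z α i ω s ^ e s ∂P := by
  set J : Finset (Fin m) := Finset.univ.filter fun s => e s ≠ 0 with hJ
  have hred : ∀ f : Fin m → ℝ, (∀ s, e s = 0 → f s = 1) → ∏ s, f s =
      ∏ k, f (J.orderEmbOfFin rfl k) := by
    intro f hf
    have h1 : ∏ s ∈ J, f s = ∏ s, f s :=
      Finset.prod_subset (Finset.subset_univ _) fun s _ hs => hf s (by simpa [hJ] using hs)
    rw [← h1]
    conv_lhs => rw [← Finset.map_orderEmbOfFin_univ J rfl, Finset.prod_map]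
    rfl
  have hsum : ∑ k, e (J.orderEmbOfFin rfl k) ≤ 8 := by
    refine le_trans (le_of_eq ?_) he
    have h1 : ∑ s ∈ J, e s = ∑ s, e s :=
      Finset.sum_subset (Finset.subset_univ _) fun s _ hs => by simpa [hJ] using hs
    rw [← h1]
    conv_rhs => rw [← Finset.map_orderEmbOfFin_univ J rfl, Finset.sum_map]
    rfl
  rw [hred (fun s => ∫ ω, Z α i ω s ^ e s ∂P) fun s hs => by simp [hs]]
  have hint : ∀ ω, ∏ s, Z α i ω s ^ e s =
      ∏ k, Z α i ω (J.orderEmbOfFin rfl k) ^ e (J.orderEmbOfFin rfl k) := fun ω =>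
    hred (fun s => Z α i ω s ^ e s) fun s hs => by simp [hs]
  simp_rw [hint]
  rcases Nat.eq_zero_or_pos J.card with h0 | h0
  · have : IsEmpty (Fin J.card) := by rw [h0]; infer_instance
    simp
  · refine hZ.factorize α i J.card (J.orderEmbOfFin rfl) (fun k => e (J.orderEmbOfFin rfl k)) h0
      (J.orderEmbOfFin rfl).injective (fun k => ?_) hsum
    have := J.orderEmbOfFin_mem rfl k
    simp only [hJ, Finset.mem_filter] at this
    exact Nat.pos_of_ne_zero this.2

/-- Mixed moments of all the components, up to order eight, factorize. -/
lemma FactorModel.integral_prod_pow (hA : FactorModel P μ S Γ Z Y) (hZ : PseudoIndependent P Δ Z)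
    {e : ((α : Fin K) × Fin (n α)) × Fin m → ℕ} (he : ∑ a, e a ≤ 8) :
    ∫ ω, ∏ a, components Z a ω ^ e a ∂P = ∏ a, ∫ ω, components Z a ω ^ e a ∂P := by
  simp_rw [Fintype.prod_prod_type]
  have h := hA.indep.integral_fun_prod_comp (fun k => (hA.measurable k.1 k.2).aemeasurable)
    (f := fun k x => ∏ s, x s ^ e (k, s)) fun k => Measurable.aestronglyMeasurable (by fun_prop)
  refine h.trans (Finset.prod_congr rfl fun k _ => ?_)
  refine hZ.integral_prod_pow k.1 k.2 (e := fun s => e (k, s)) (le_trans ?_ he)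
  rw [Fintype.sum_prod_type]
  exact Finset.single_le_sum (f := fun k => ∑ s, e (k, s)) (fun _ _ => Nat.zero_le _)
    (Finset.mem_univ k)

omit [IsProbabilityMeasure P] in
lemma PseudoIndependent.memLp_four (hA : FactorModel P μ S Γ Z Y) (hZ : PseudoIndependent P Δ Z)
    (a : ((α : Fin K) × Fin (n α)) × Fin m) : MemLp (components Z a) 4 P := by
  have hm : Measurable (components Z a) :=
    (measurable_pi_apply a.2).comp (hA.measurable a.1.1 a.1.2)
  rw [← integrable_norm_rpow_iff hm.aestronglyMeasurable (by simp) (by simp)]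
  refine (hZ.integrable_four a.1.1 a.1.2 a.2).congr (Eventually.of_forall fun ω => ?_)
  simp only [components, Real.norm_eq_abs]
  rw [show (ENNReal.toReal 4) = ((4 : ℕ) : ℝ) by simp, Real.rpow_natCast]
  exact (Even.pow_abs (by decide) _).symm

omit [IsProbabilityMeasure P] in
lemma FactorModel.integral_sq (hA : FactorModel P μ S Γ Z Y)
    (a : ((α : Fin K) × Fin (n α)) × Fin m) : ∫ ω, components Z a ω ^ 2 ∂P = 1 := by
  have h := hA.cov a.1.1 a.1.2 a.2 a.2
  simp only [covariance, hA.mean, sub_zero, Matrix.one_apply_eq] at h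
  rw [← h]
  exact integral_congr_ae (Eventually.of_forall fun ω => sq _)

lemma FactorModel.isWhiteNoise_components (hA : FactorModel P μ S Γ Z Y)
    (hZ : PseudoIndependent P Δ Z) : IsWhiteNoise P Δ (components Z) := by
  have h1 : ∀ a, ∫ ω, components Z a ω ∂P = 0 := fun a => hA.mean a.1.1 a.1.2 a.2
  have h2 := hA.integral_sq
  have h4 : ∀ a, ∫ ω, components Z a ω ^ 4 ∂P = 3 + Δ := fun a => hZ.moment_four a.1.1 a.1.2 a.2
  refine ⟨hZ.memLp_four hA, fun a b => ?_, fun a b c d => ?_⟩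
  · have hexp : ∀ ω, components Z a ω * components Z b ω =
        ∏ x, components Z x ω ^ ((if x = a then 1 else 0) + (if x = b then 1 else 0)) := by
      intro ω
      simp_rw [pow_add, Finset.prod_mul_distrib]
      simp [pow_ite]
    simp_rw [hexp]
    rw [hA.integral_prod_pow hZ (by simp [Finset.sum_add_distrib])]
    split_ifs with hab
    · subst hab
      refine Finset.prod_eq_one fun x _ => ?_
      by_cases hx : x = a <;> simp [hx, h2]
    · exact Finset.prod_eq_zero (Finset.mem_univ a) (by simp [hab, h1])
  · have hexp : ∀ ω, (components Z a ω * components Z b ω) * (components Z c ω * components Z d ω) =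
        ∏ x, components Z x ω ^ ((if x = a then 1 else 0) + (if x = b then 1 else 0) +
          (if x = c then 1 else 0) + (if x = d then 1 else 0)) := by
      intro ω
      simp_rw [pow_add, Finset.prod_mul_distrib]
      simp [pow_ite, mul_assoc]
    simp_rw [hexp]
    rw [hA.integral_prod_pow hZ (by simp [Finset.sum_add_distrib])]
    -- An index that occurs once contributes the factor zero; otherwise the indices agree in pairs.
    by_cases hab : a = b
    · subst hab
      by_cases hcd : c = d
      · subst hcd
        by_cases hac : a = c
        · subst hac
          rw [Finset.prod_eq_single a (fun x _ hx => by simp [hx]) (by simp)]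
          simp only [if_true, Nat.reduceAdd, h4]
          ring
        · rw [Finset.prod_eq_one fun x _ => ?_]
          · simp [hac]
          · by_cases hx : x = a
            · subst hx; simp [hac, h2]
            · by_cases hx' : x = c <;> simp [hx, hx', h2, Ne.symm hac]
      · by_cases hac : a = c
        · subst hac
          rw [Finset.prod_eq_zero (Finset.mem_univ d) (by simp [Ne.symm hcd, h1])]
          simp [hcd]
        · rw [Finset.prod_eq_zero (Finset.mem_univ c) (by simp [Ne.symm hac, hcd, h1])]
          simp [hcd, hac]
    · by_cases hac : a = c
      · subst hac
        by_cases hbd : b = d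
        · subst hbd
          rw [Finset.prod_eq_one fun x _ => ?_]
          · simp [hab]
          · by_cases hx : x = a
            · subst hx; simp [hab, h2]
            · by_cases hx' : x = b <;> simp [hx, hx', h2, Ne.symm hab]
        · rw [Finset.prod_eq_zero (Finset.mem_univ b) (by simp [Ne.symm hab, hbd, h1])]
          simp [hab, hbd, Ne.symm hab]
      · by_cases had : a = d
        · subst had
          by_cases hbc : b = c
          · subst hbc
            rw [Finset.prod_eq_one fun x _ => ?_]
            · simp [hab]
            · by_cases hx : x = a
              · subst hx; simp [hab, h2]
              · by_cases hx' : x = b <;> simp [hx, hx', h2, Ne.symm hab]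
          · rw [Finset.prod_eq_zero (Finset.mem_univ b) (by simp [Ne.symm hab, hbc, h1])]
            simp [hab, hbc, hac]
        · rw [Finset.prod_eq_zero (Finset.mem_univ a) (by simp [hab, hac, had, h1])]
          simp [hab, hac, had]

lemma FactorModel.isBlockNoise_components (hA : FactorModel P μ S Γ Z Y)
    (hZ : PseudoIndependent P Δ Z) : IsBlockNoise P Δ (components Z) where
  toIsWhiteNoise := hA.isWhiteNoise_components hZ
  measurable a := (measurable_pi_apply a.2).comp (hA.measurable a.1.1 a.1.2)
  mean a := hA.mean a.1.1 a.1.2 a.2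
  indep k := by
    have h := hA.indep.indepFun_finset {k} {k}ᶜ disjoint_compl_right fun k =>
      hA.measurable k.1 k.2
    let f : (({k} : Finset ((α : Fin K) × Fin (n α))) → Fin m → ℝ) → Fin m → ℝ :=
      fun y => y ⟨k, Finset.mem_singleton_self k⟩
    let g : ((({k} : Finset ((α : Fin K) × Fin (n α)))ᶜ : Finset _) → Fin m → ℝ) →
        ((α : Fin K) × Fin (n α)) × Fin m → ℝ :=
      fun y a => if h : a.1 = k then 0 else y ⟨a.1, by simpa using h⟩ a.2
    have hf : Measurable f := measurable_pi_apply _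
    have hg : Measurable g := by
      refine measurable_pi_lambda _ fun a => ?_
      by_cases ha : a.1 = k
      · simp only [g, ha, dite_true]
        exact measurable_const
      · simp only [g, ha, dite_false]
        exact (measurable_pi_apply a.2).comp (measurable_pi_apply _)
    exact h.comp hf hg

end Model

/-! ### The statistic as a block quadratic form -/

section Interaction

variable {K p m : ℕ} {n : Fin K → ℕ} {ρ : Type*} [Fintype ρ]

/-- The weight, in twice the statistic, of the pairs of distinct observations
from the groups `α` and `β`. -/
noncomputable def pairWeight (d : Matrix (Fin K) (Fin K) ℝ) (n : Fin K → ℕ) (α β : Fin K) : ℝ :=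
  if α = β then 2 * (d α α / ((n α : ℝ) * ((n α : ℝ) - 1)))
  else 2 * (d α β / ((n α : ℝ) * (n β : ℝ)))

lemma pairWeight_symm {d : Matrix (Fin K) (Fin K) ℝ} (hd : ∀ α β, d α β = d β α) (α β : Fin K) :
    pairWeight d n α β = pairWeight d n β α := by
  unfold pairWeight
  by_cases h : α = β
  · subst h; rfl
  · rw [if_neg h, if_neg (Ne.symm h), hd, mul_comm (n α : ℝ)]

/-- The block matrix with zero diagonal blocks, whose block at two distinct observations from the
groups `α` and `β` is `g_{αβ} Q_αᵀ Q_β`. -/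
noncomputable def interaction (n : Fin K → ℕ) (g : Fin K → Fin K → ℝ)
    (Q : Fin K → Matrix ρ (Fin m) ℝ) :
    Matrix (((α : Fin K) × Fin (n α)) × Fin m) (((α : Fin K) × Fin (n α)) × Fin m) ℝ :=
  fun a b => if a.1 = b.1 then 0 else g a.1.1 b.1.1 * ((Q a.1.1)ᵀ * Q b.1.1) a.2 b.2

variable {g : Fin K → Fin K → ℝ} {Q : Fin K → Matrix ρ (Fin m) ℝ}

lemma gram_apply_symm (A B : Matrix ρ (Fin m) ℝ) (s t : Fin m) :
    (Aᵀ * B) s t = (Bᵀ * A) t s := by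
  rw [← Matrix.transpose_apply (Bᵀ * A), Matrix.transpose_mul, Matrix.transpose_transpose]

lemma interaction_symm (hg : ∀ α β, g α β = g β α) (a b) :
    interaction n g Q a b = interaction n g Q b a := by
  unfold interaction
  by_cases h : a.1 = b.1
  · rw [if_pos h, if_pos h.symm]
  · rw [if_neg h, if_neg (Ne.symm h), hg, gram_apply_symm]

lemma interaction_diag (k : (α : Fin K) × Fin (n α)) (s t : Fin m) :
    interaction n g Q (k, s) (k, t) = 0 := if_pos rfl

lemma interaction_div (c : ℝ) (a b) :
    interaction n (fun α β => g α β / c) Q a b = interaction n g Q a b / c := by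
  unfold interaction
  split_ifs
  · simp
  · ring

/-- The squared Frobenius norm of `g_{αβ} Q_αᵀ Q_β`. -/
noncomputable def pairEnergy (g : Fin K → Fin K → ℝ) (Q : Fin K → Matrix ρ (Fin m) ℝ)
    (α β : Fin K) : ℝ :=
  ∑ s, ∑ t, (g α β * ((Q α)ᵀ * Q β) s t) ^ 2

lemma sum_interaction_block_sq (k l : (α : Fin K) × Fin (n α)) :
    ∑ s, ∑ t, interaction n g Q (k, s) (l, t) ^ 2 = if k = l then 0 else pairEnergy g Q k.1 l.1 := by
  unfold interaction pairEnergy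
  by_cases h : k = l <;> simp [h]

lemma blockEnergy_interaction (k : (α : Fin K) × Fin (n α)) :
    blockEnergy (interaction n g Q) k =
      ∑ l : (α : Fin K) × Fin (n α), pairEnergy g Q k.1 l.1 - pairEnergy g Q k.1 k.1 := by
  have h : blockEnergy (interaction n g Q) k =
      ∑ l, if k = l then 0 else pairEnergy g Q k.1 l.1 := by
    simp_rw [← sum_interaction_block_sq, blockEnergy, Fintype.sum_prod_type]
    exact Finset.sum_comm
  have h2 : ∀ l, (if k = l then 0 else pairEnergy g Q k.1 l.1) =
      pairEnergy g Q k.1 l.1 - if k = l then pairEnergy g Q k.1 l.1 else 0 := fun l => by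
    split_ifs <;> simp
  rw [h]
  simp_rw [h2, Finset.sum_sub_distrib]
  simp

/-- All block rows within one group carry the same energy, so none of them carries more than the
share `1 / n_α` of the total. -/
lemma mul_blockEnergy_interaction_le (k : (α : Fin K) × Fin (n α)) :
    (n k.1 : ℝ) * blockEnergy (interaction n g Q) k ≤ ∑ a, ∑ b, interaction n g Q a b ^ 2 := by
  rw [← sum_blockEnergy, Fintype.sum_sigma]
  have h : ∑ i : Fin (n k.1), blockEnergy (interaction n g Q) ⟨k.1, i⟩ =
      (n k.1 : ℝ) * blockEnergy (interaction n g Q) k := by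
    simp only [blockEnergy_interaction, Finset.sum_const, Finset.card_univ, Fintype.card_fin,
      nsmul_eq_mul]
  rw [← h]
  exact Finset.single_le_sum
    (f := fun α => ∑ i : Fin (n α), blockEnergy (interaction n g Q) ⟨α, i⟩)
    (fun α _ => Finset.sum_nonneg fun i _ => blockEnergy_nonneg _ _) (Finset.mem_univ k.1)

lemma trace_transpose_mul_self (A : Matrix (Fin m) (Fin m) ℝ) :
    (Aᵀ * A).trace = ∑ s, ∑ t, A s t ^ 2 := by
  simp only [Matrix.trace, Matrix.diag, Matrix.mul_apply, Matrix.transpose_apply, sq]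
  exact Finset.sum_comm

lemma trace_weighted_two {W : Matrix (Fin p) (Fin p) ℝ} {L : Matrix ρ (Fin p) ℝ}
    (hW : W = Lᵀ * L) (A B : Matrix (Fin p) (Fin m) ℝ) :
    (W * (A * Aᵀ) * W * (B * Bᵀ)).trace = ∑ s, ∑ t, ((L * A)ᵀ * (L * B)) s t ^ 2 := by
  rw [← trace_transpose_mul_self]
  calc _ = ((Lᵀ * L * A * Aᵀ * Lᵀ * L * B) * Bᵀ).trace := by simp only [hW, Matrix.mul_assoc]
    _ = (Bᵀ * (Lᵀ * L * A * Aᵀ * Lᵀ * L * B)).trace := Matrix.trace_mul_comm _ _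
    _ = _ := by
      simp only [Matrix.transpose_mul, Matrix.transpose_transpose, Matrix.mul_assoc]

lemma trace_weighted_four {W : Matrix (Fin p) (Fin p) ℝ} {L : Matrix ρ (Fin p) ℝ}
    (hW : W = Lᵀ * L) (A B C : Matrix (Fin p) (Fin m) ℝ) :
    (W * (A * Aᵀ) * W * (B * Bᵀ) * W * (C * Cᵀ) * W * (B * Bᵀ)).trace =
      ∑ s, ∑ t, (((L * A)ᵀ * (L * B)) * ((L * B)ᵀ * (L * C))) s t ^ 2 := by
  rw [← trace_transpose_mul_self]
  calc _ = ((Lᵀ * L * A * Aᵀ * Lᵀ * L * B * Bᵀ * Lᵀ * L * C) * (Cᵀ * Lᵀ * L * B * Bᵀ)).trace := by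
        simp only [hW, Matrix.mul_assoc]
    _ = ((Cᵀ * Lᵀ * L * B * Bᵀ) * (Lᵀ * L * A * Aᵀ * Lᵀ * L * B * Bᵀ * Lᵀ * L * C)).trace :=
        Matrix.trace_mul_comm _ _
    _ = _ := by
      simp only [Matrix.transpose_mul, Matrix.transpose_transpose, Matrix.mul_assoc]

/-- A factor `L` of the weight matrix `W = Lᵀ L`: the rows of `diag(b)` followed by the row `aᵀ`. -/
def weightFactor (a b : Fin p → ℝ) : Matrix (Fin p ⊕ Unit) (Fin p) ℝ :=
  Matrix.fromRows (Matrix.diagonal b) (Matrix.replicateRow Unit a)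

lemma weightMatrix_eq (a b : Fin p → ℝ) :
    weightMatrix a b = (weightFactor a b)ᵀ * weightFactor a b := by
  rw [weightMatrix, weightFactor, Matrix.transpose_fromRows, Matrix.fromCols_mul_fromRows,
    Matrix.diagonal_transpose, Matrix.diagonal_mul_diagonal, Matrix.transpose_replicateRow,
    Matrix.vecMulVec_eq Unit]
  simp only [sq]

/-- The trace condition on the groups bounds the fourth-order energy of the block matrix. -/
lemma sum_interaction_mul_self_sq_le {ε : ℝ} (hε : 0 ≤ ε)
    (h : ∀ α β γ, ∑ s, ∑ t, (((Q α)ᵀ * Q β) * ((Q β)ᵀ * Q γ)) s t ^ 2 ≤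
      ε * ((∑ s, ∑ t, ((Q α)ᵀ * Q β) s t ^ 2) * ∑ s, ∑ t, ((Q γ)ᵀ * Q β) s t ^ 2)) :
    ∑ a, ∑ b, (interaction n g Q * interaction n g Q) a b ^ 2 ≤
      ε * (∑ a, ∑ b, interaction n g Q a b ^ 2) ^ 2 := by
  refine sum_mul_self_sq_le hε fun k l l' => ?_
  by_cases hkl : k = l
  · simp [interaction, hkl]
  by_cases hll : l = l'
  · simp [interaction, hll]
  have e1 : ∀ s t, (∑ u, interaction n g Q (k, s) (l, u) * interaction n g Q (l, u) (l', t)) =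
      (g k.1 l.1 * g l.1 l'.1) * (((Q k.1)ᵀ * Q l.1) * ((Q l.1)ᵀ * Q l'.1)) s t := by
    intro s t
    rw [Matrix.mul_apply, Finset.mul_sum]
    refine Finset.sum_congr rfl fun u _ => ?_
    simp only [interaction, if_neg hkl, if_neg hll]
    ring
  have e2 : ∑ s, ∑ t, ((Q l'.1)ᵀ * Q l.1) s t ^ 2 = ∑ s, ∑ t, ((Q l.1)ᵀ * Q l'.1) s t ^ 2 := by
    rw [Finset.sum_comm]
    simp_rw [gram_apply_symm (Q l'.1) (Q l.1)]
  simp_rw [e1, mul_pow _ _ 2, ← Finset.mul_sum]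
  simp only [interaction, if_neg hkl, if_neg hll]
  simp_rw [mul_pow (g _ _), ← Finset.mul_sum]
  have h1 := mul_le_mul_of_nonneg_left (h k.1 l.1 l'.1)
    (mul_nonneg (sq_nonneg (g k.1 l.1)) (sq_nonneg (g l.1 l'.1)))
  rw [e2] at h1
  linarith

/-- A weighted double sum over distinct observations, split into its within-group and
between-group parts. -/
lemma sum_pairWeight_mul (d : Matrix (Fin K) (Fin K) ℝ)
    (e : (k l : (α : Fin K) × Fin (n α)) → ℝ) :
    ∑ k, ∑ l, (if k = l then 0 else pairWeight d n k.1 l.1 * e k l) =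
      2 * (∑ α, d α α * ((∑ i, ∑ j ∈ Finset.univ.filter (fun j => j ≠ i), e ⟨α, i⟩ ⟨α, j⟩) /
          ((n α : ℝ) * ((n α : ℝ) - 1))) +
        ∑ α, ∑ β ∈ Finset.univ.filter (fun β => β ≠ α),
          d α β * ((∑ i, ∑ j, e ⟨α, i⟩ ⟨β, j⟩) / ((n α : ℝ) * (n β : ℝ)))) := by
  simp_rw [Fintype.sum_sigma]
  rw [← Finset.sum_add_distrib, Finset.mul_sum]
  refine Finset.sum_congr rfl fun α _ => ?_
  rw [Finset.sum_comm, ← Finset.add_sum_erase _ _ (Finset.mem_univ α), Finset.filter_ne',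
    mul_add, Finset.mul_sum]
  congr 1
  · have h1 : ∀ i : Fin (n α), ∑ j : Fin (n α),
        (if (⟨α, i⟩ : (α : Fin K) × Fin (n α)) = ⟨α, j⟩ then 0
          else pairWeight d n α α * e ⟨α, i⟩ ⟨α, j⟩) =
        pairWeight d n α α * ∑ j ∈ Finset.univ.filter (fun j => j ≠ i), e ⟨α, i⟩ ⟨α, j⟩ := by
      intro i
      rw [Finset.mul_sum, Finset.sum_filter]
      refine Finset.sum_congr rfl fun j _ => ?_
      by_cases hij : i = j
      · simp [hij]
      · rw [if_neg fun h => hij (by simpa using h), if_pos (Ne.symm hij)]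
    simp_rw [h1]
    rw [← Finset.mul_sum, pairWeight, if_pos rfl]
    ring
  · refine Finset.sum_congr rfl fun β hβ => ?_
    have hαβ : α ≠ β := (Finset.ne_of_mem_erase hβ).symm
    have h1 : ∀ (i : Fin (n α)) (j : Fin (n β)),
        (if (⟨α, i⟩ : (α : Fin K) × Fin (n α)) = ⟨β, j⟩ then 0
          else pairWeight d n α β * e ⟨α, i⟩ ⟨β, j⟩) = pairWeight d n α β * e ⟨α, i⟩ ⟨β, j⟩ :=
      fun i j => if_neg fun h => hαβ (congrArg Sigma.fst h)
    simp_rw [h1, ← Finset.mul_sum]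
    rw [pairWeight, if_neg hαβ]
    ring

lemma dotProduct_mulVec_factor {L : Matrix ρ (Fin p) ℝ} (A B : Matrix (Fin p) (Fin m) ℝ)
    (x y : Fin m → ℝ) :
    (A *ᵥ x) ⬝ᵥ ((Lᵀ * L) *ᵥ (B *ᵥ y)) =
      ∑ s, ∑ t, ((L * A)ᵀ * (L * B)) s t * (x s * y t) := by
  have h1 : (A *ᵥ x) ⬝ᵥ ((Lᵀ * L) *ᵥ (B *ᵥ y)) = x ⬝ᵥ (((L * A)ᵀ * (L * B)) *ᵥ y) := by
    rw [← Matrix.vecMul_transpose, ← Matrix.dotProduct_mulVec]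
    simp only [Matrix.mulVec_mulVec, Matrix.transpose_mul, Matrix.mul_assoc]
  rw [h1]
  simp only [dotProduct, Matrix.mulVec, Finset.mul_sum]
  exact Finset.sum_congr rfl fun s _ => Finset.sum_congr rfl fun t _ => by ring

/-- The statistic is half the quadratic form of the interaction matrix in the noise components. -/
lemma centredStatistic_eq_quadForm {Ω : Type*} [MeasurableSpace Ω] {P : Measure Ω}
    {μ : Fin K → Fin p → ℝ} {S : Fin K → Matrix (Fin p) (Fin p) ℝ}
    {Γ : Fin K → Matrix (Fin p) (Fin m) ℝ} {Z : (α : Fin K) → Fin (n α) → Ω → Fin m → ℝ}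
    {Y : (α : Fin K) → Fin (n α) → Ω → Fin p → ℝ} (hA : FactorModel P μ S Γ Z Y)
    (d : Matrix (Fin K) (Fin K) ℝ) (L : Matrix ρ (Fin p) ℝ) (ω : Ω) :
    centredStatistic d (Lᵀ * L) μ Y ω =
      quadForm (interaction n (pairWeight d n) fun α => L * Γ α)
        (fun a => components Z a ω) / 2 := by
  have hX : ∀ α i, Y α i ω - μ α = Γ α *ᵥ Z α i ω := fun α i => by
    rw [hA.model, add_sub_cancel_right]
  have hQ : quadForm (interaction n (pairWeight d n) fun α => L * Γ α)
      (fun a => components Z a ω) = ∑ k : (α : Fin K) × Fin (n α), ∑ l : (α : Fin K) × Fin (n α),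
        (if k = l then 0 else pairWeight d n k.1 l.1 *
          ((Γ k.1 *ᵥ Z k.1 k.2 ω) ⬝ᵥ ((Lᵀ * L) *ᵥ (Γ l.1 *ᵥ Z l.1 l.2 ω)))) := by
    unfold quadForm
    simp_rw [Fintype.sum_prod_type]
    refine Finset.sum_congr rfl fun k _ => ?_
    rw [Finset.sum_comm]
    refine Finset.sum_congr rfl fun l _ => ?_
    rw [dotProduct_mulVec_factor]
    by_cases hkl : k = l
    · simp [interaction, hkl]
    · simp only [interaction, if_neg hkl, Finset.mul_sum, components]
      exact Finset.sum_congr rfl fun s _ => Finset.sum_congr rfl fun t _ => by ring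
  rw [hQ, sum_pairWeight_mul d fun k l =>
    (Γ k.1 *ᵥ Z k.1 k.2 ω) ⬝ᵥ ((Lᵀ * L) *ᵥ (Γ l.1 *ᵥ Z l.1 l.2 ω)),
    mul_div_cancel_left₀ _ (two_ne_zero' ℝ)]
  simp only [centredStatistic, withinU, betweenU, hX]

end Interaction

/-! ### Variance of the statistic and asymptotic normality -/

lemma coeff_symm {q K : ℕ} (G₀ : Matrix (Fin q) (Fin K) ℝ) (n : Fin K → ℕ) (α β : Fin K) :
    coeff G₀ n α β = coeff G₀ n β α := by
  unfold coeff
  rw [← Matrix.transpose_apply (_ * _), Matrix.transpose_mul, Matrix.transpose_transpose]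

lemma quadForm_div {σ : Type*} [Fintype σ] {B B' : Matrix σ σ ℝ} {c : ℝ}
    (h : ∀ a b, B' a b = B a b / c) (x : σ → ℝ) : quadForm B' x = quadForm B x / c := by
  simp only [quadForm, h, Finset.sum_div]
  exact Finset.sum_congr rfl fun a _ => Finset.sum_congr rfl fun b _ => by ring

/-- A quadratic form with zero diagonal is centred, and its variance is the energy of its
matrix. -/
lemma IsWhiteNoise.variance_half_quadForm {Ω : Type*} [MeasurableSpace Ω] {P : Measure Ω}
    [IsProbabilityMeasure P] {σ : Type*} [Fintype σ] [DecidableEq σ] {Δ : ℝ} {z : σ → Ω → ℝ}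
    (hz : IsWhiteNoise P Δ z) {B : Matrix σ σ ℝ} (hB : ∀ a b, B a b = B b a)
    (hB0 : ∀ a, B a a = 0) :
    Var[fun ω => quadForm B (fun a => z a ω) / 2; P] = (∑ a, ∑ b, B a b ^ 2) / 2 := by
  have htr : B.trace = 0 := Finset.sum_eq_zero fun a _ => hB0 a
  have hm : MemLp (fun ω => quadForm B (fun a => z a ω) / 2) 2 P := by
    simp_rw [div_eq_mul_inv]
    exact (hz.memLp_quadForm B).mul_const _
  rw [variance_eq_sub hm]
  have h1 : ∫ ω, quadForm B (fun a => z a ω) / 2 ∂P = 0 := by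
    rw [integral_div, hz.integral_quadForm, htr, zero_div]
  have h2 : ∫ ω, ((fun ω => quadForm B (fun a => z a ω) / 2) ^ 2) ω ∂P =
      (∑ a, ∑ b, B a b ^ 2) / 2 := by
    simp only [Pi.pow_apply, div_pow]
    rw [integral_div, hz.integral_quadForm_sq hB, htr]
    simp only [hB0]
    norm_num
    ring
  rw [h1, h2]
  ring

lemma halfFormCharFun_eq_charFun {Ω : Type*} [MeasurableSpace Ω] {P : Measure Ω} {ι κ : Type*}
    [Fintype ι] [Fintype κ] {z : ι × κ → Ω → ℝ} (hz : ∀ a, Measurable (z a))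
    (M : Matrix (ι × κ) (ι × κ) ℝ) (t : ℝ) :
    charFun (P.map fun ω => quadForm M (fun a => z a ω) / 2) t = halfFormCharFun P z M t := by
  have hm : Measurable fun ω => quadForm M (fun a => z a ω) / 2 :=
    ((measurable_quadForm M).comp (measurable_pi_lambda _ hz)).div_const 2
  rw [charFun_apply_real, integral_map hm.aemeasurable (by fun_prop)]
  refine integral_congr_ae (Eventually.of_forall fun ω => ?_)
  simp only [halfFormChar, Complex.ofReal_mul]

end GLHT

open GLHT

theorem theorem2p2 {K q : ℕ} (hq : 0 < q) (hqK : q < K)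
    -- the fixed coefficient matrix of the hypothesis, of full row rank
    (G₀ : Matrix (Fin q) (Fin K) ℝ) (hG₀ : G₀.rank = q)
    -- along a sequence `ν → ∞`: the sample sizes and the dimensions
    (n : ℕ → Fin K → ℕ) (p m : ℕ → ℕ)
    (hn : Tendsto (fun ν => ∑ α, n ν α) atTop atTop) (hp : Tendsto p atTop atTop)
    -- the means and standard deviations of the weight densities
    (a b : (ν : ℕ) → Fin (p ν) → ℝ) (hb : ∀ ν i, 0 < b ν i)
    -- the data
    (Ω : ℕ → Type*) [∀ ν, MeasurableSpace (Ω ν)]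
    (P : (ν : ℕ) → Measure (Ω ν)) [∀ ν, IsProbabilityMeasure (P ν)]
    (μ : (ν : ℕ) → Fin K → Fin (p ν) → ℝ)
    (S : (ν : ℕ) → Fin K → Matrix (Fin (p ν)) (Fin (p ν)) ℝ)
    (Γ : (ν : ℕ) → Fin K → Matrix (Fin (p ν)) (Fin (m ν)) ℝ)
    (Z : (ν : ℕ) → (α : Fin K) → Fin (n ν α) → Ω ν → Fin (m ν) → ℝ)
    (Y : (ν : ℕ) → (α : Fin K) → Fin (n ν α) → Ω ν → Fin (p ν) → ℝ)
    -- factor model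
    (hA1 : ∀ ν, GLHT.FactorModel (P ν) (μ ν) (S ν) (Γ ν) (Z ν) (Y ν))
    -- moment conditions
    (Δ : ℝ) (hA2 : ∀ ν, GLHT.PseudoIndependent (P ν) Δ (Z ν))
    -- proportional sample sizes
    (τ : Fin K → ℝ) (hτ : ∀ α, τ α ∈ Set.Ioo (0 : ℝ) 1)
    (hA3 : ∀ α, Tendsto (fun ν => (n ν α : ℝ) / ((∑ β, n ν β : ℕ) : ℝ)) atTop (𝓝 (τ α)))
    -- trace condition
    (hA4 : ∀ α β γ : Fin K,
      (fun ν => (GLHT.weightMatrix (a ν) (b ν) * S ν α * GLHT.weightMatrix (a ν) (b ν) * S ν β *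
          GLHT.weightMatrix (a ν) (b ν) * S ν γ * GLHT.weightMatrix (a ν) (b ν) * S ν β).trace)
        =o[atTop]
      (fun ν =>
        (GLHT.weightMatrix (a ν) (b ν) * S ν α * GLHT.weightMatrix (a ν) (b ν) * S ν β).trace *
        (GLHT.weightMatrix (a ν) (b ν) * S ν γ * GLHT.weightMatrix (a ν) (b ν) * S ν β).trace))
    -- the normalization by the standard deviation makes sense for large `ν`
    (hσ : ∀ᶠ ν in atTop, 0 < GLHT.stdDev (P ν)
      (GLHT.centredStatistic (GLHT.coeff G₀ (n ν)) (GLHT.weightMatrix (a ν) (b ν)) (μ ν) (Y ν))) :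
    TendstoInDistribution
      (fun ν ω =>
        GLHT.centredStatistic (GLHT.coeff G₀ (n ν)) (GLHT.weightMatrix (a ν) (b ν)) (μ ν) (Y ν) ω /
          GLHT.stdDev (P ν) (GLHT.centredStatistic (GLHT.coeff G₀ (n ν))
            (GLHT.weightMatrix (a ν) (b ν)) (μ ν) (Y ν)))
      atTop (id : ℝ → ℝ) P (gaussianReal 0 1) := by
  set σ : ℕ → ℝ := fun ν => stdDev (P ν) (centredStatistic (coeff G₀ (n ν))
    (weightMatrix (a ν) (b ν)) (μ ν) (Y ν)) with hσdef
  set Q : (ν : ℕ) → Fin K → Matrix (Fin (p ν) ⊕ Unit) (Fin (m ν)) ℝ := fun ν α =>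
    weightFactor (a ν) (b ν) * Γ ν α with hQ
  set g : ℕ → Fin K → Fin K → ℝ := fun ν => pairWeight (coeff G₀ (n ν)) (n ν) with hg
  have hgs : ∀ ν α β, g ν α β = g ν β α := fun ν => pairWeight_symm (coeff_symm G₀ (n ν))
  have hz : ∀ ν, IsBlockNoise (P ν) Δ (components (Z ν)) := fun ν =>
    (hA1 ν).isBlockNoise_components (hA2 ν)
  have hT : ∀ ν, centredStatistic (coeff G₀ (n ν)) (weightMatrix (a ν) (b ν)) (μ ν) (Y ν) =
      fun ω => quadForm (interaction (n ν) (g ν) (Q ν)) (fun x => components (Z ν) x ω) / 2 :=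
    fun ν => funext fun ω => by
      rw [weightMatrix_eq, centredStatistic_eq_quadForm (hA1 ν)]
  set M := fun ν => interaction (n ν) (fun α β => g ν α β / σ ν) (Q ν) with hMdef
  have hTM : ∀ ν, (fun ω => centredStatistic (coeff G₀ (n ν)) (weightMatrix (a ν) (b ν))
      (μ ν) (Y ν) ω / σ ν) = fun ω => quadForm (M ν) (fun x => components (Z ν) x ω) / 2 :=
    fun ν => funext fun ω => by
      rw [hT, quadForm_div (B' := M ν) fun x y => interaction_div (σ ν) x y]
      ring
  have hσ2 : ∀ ν, σ ν ^ 2 = (∑ x, ∑ y, interaction (n ν) (g ν) (Q ν) x y ^ 2) / 2 := by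
    intro ν
    rw [hσdef]
    simp only [stdDev]
    rw [Real.sq_sqrt (variance_nonneg _ _), hT]
    exact (hz ν).variance_half_quadForm (interaction_symm (hgs ν)) fun x => interaction_diag _ _ _
  have hM2 : ∀ ν, 0 < σ ν → ∑ x, ∑ y, M ν x y ^ 2 = 2 := by
    intro ν hν
    have h1 : ∀ x y, M ν x y ^ 2 = interaction (n ν) (g ν) (Q ν) x y ^ 2 / σ ν ^ 2 := fun x y => by
      rw [hMdef]
      simp only
      rw [interaction_div, div_pow]
    simp_rw [h1, ← Finset.sum_div]
    rw [div_eq_iff (by positivity), hσ2]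
    ring
  -- The identity for `T / σ` and measurability hold for every `ν`, also where `σ ν = 0`.
  have hmeas : ∀ ν, Measurable fun ω => quadForm (M ν) (fun x => components (Z ν) x ω) / 2 :=
    fun ν => ((measurable_quadForm _).comp
      (measurable_pi_lambda _ (hz ν).measurable)).div_const 2
  have hsize : ∀ α, Tendsto (fun ν => (n ν α : ℝ)) atTop atTop := by
    intro α
    have h1 : Tendsto (fun ν => ((∑ β, n ν β : ℕ) : ℝ)) atTop atTop :=
      tendsto_natCast_atTop_atTop.comp hn
    refine ((hA3 α).pos_mul_atTop (hτ α).1 h1).congr' ?_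
    filter_upwards [h1.eventually_gt_atTop 0] with ν hν
    exact div_mul_cancel₀ _ hν.ne'
  have htrace : ∀ ε : ℝ, 0 < ε → ∀ᶠ ν in atTop, ∀ α β γ,
      ∑ s, ∑ t, (((Q ν α)ᵀ * Q ν β) * ((Q ν β)ᵀ * Q ν γ)) s t ^ 2 ≤
      ε * ((∑ s, ∑ t, ((Q ν α)ᵀ * Q ν β) s t ^ 2) * ∑ s, ∑ t, ((Q ν γ)ᵀ * Q ν β) s t ^ 2) := by
    intro ε hε
    refine eventually_all.2 fun α => eventually_all.2 fun β => eventually_all.2 fun γ => ?_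
    filter_upwards [(hA4 α β γ).def hε] with ν hν
    rw [← (hA1 ν).factor α, ← (hA1 ν).factor β, ← (hA1 ν).factor γ,
      trace_weighted_four (weightMatrix_eq (a ν) (b ν)),
      trace_weighted_two (weightMatrix_eq (a ν) (b ν)),
      trace_weighted_two (weightMatrix_eq (a ν) (b ν)), Real.norm_eq_abs, Real.norm_eq_abs,
      abs_of_nonneg, abs_of_nonneg] at hν
    · exact hν
    all_goals positivity
  have hlim : ∀ t : ℝ, Tendsto (fun ν => halfFormCharFun (P ν) (components (Z ν)) (M ν) t) atTop
      (𝓝 (Complex.exp (-(t ^ 2) / 2))) := by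
    intro t
    rw [Metric.tendsto_nhds]
    intro δ hδ
    set C : ℝ := |t| * (t ^ 2 * (2 + 2 * (3 + |Δ|) ^ 2) + |t| * (3 + |Δ|)) with hC
    have hC0 : 0 ≤ C := by positivity
    -- With `η = ρ = r` the error bound at `t` equals `C r`.
    set r : ℝ := δ / (C + 1) with hr
    have hr0 : 0 < r := by positivity
    have hCr : C * r < δ := by
      rw [hr, mul_div_assoc', div_lt_iff₀ (by positivity)]
      linarith
    filter_upwards [hσ, htrace (r ^ 2 / 4) (by positivity),
      eventually_all.2 fun α => (hsize α).eventually_ge_atTop (2 / r ^ 2)] with ν hν htr hnα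
    have hM2ν := hM2 ν hν
    have hk : ∀ k, blockEnergy (M ν) k ≤ r ^ 2 := by
      intro k
      have h1 := mul_blockEnergy_interaction_le (g := fun α β => g ν α β / σ ν) (Q := Q ν) k
      have h2 := mul_le_mul_of_nonneg_right (hnα k.1) (blockEnergy_nonneg (M ν) k)
      have h3 : 2 / r ^ 2 * blockEnergy (M ν) k ≤ 2 := h2.trans (h1.trans_eq hM2ν)
      rw [div_mul_eq_mul_div, div_le_iff₀ (by positivity)] at h3
      linarith
    have hM4 : ∑ x, ∑ y, (M ν * M ν) x y ^ 2 ≤ r ^ 2 := by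
      refine (sum_interaction_mul_self_sq_le (by positivity) htr).trans_eq ?_
      change r ^ 2 / 4 * (∑ x, ∑ y, M ν x y ^ 2) ^ 2 = r ^ 2
      rw [hM2ν]
      ring
    have hfin := (hz ν).norm_halfFormCharFun_sub_le (M := M ν)
      (interaction_symm fun α β => by rw [hgs]) interaction_diag hM2ν hr0 hr0 hk hM4 t
    rw [dist_eq_norm]
    refine hfin.trans_lt (lt_of_eq_of_lt ?_ hCr)
    rw [hC]
    ring
  have hfun : (fun ν ω => centredStatistic (coeff G₀ (n ν)) (weightMatrix (a ν) (b ν)) (μ ν)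
      (Y ν) ω / σ ν) = fun ν ω => quadForm (M ν) (fun x => components (Z ν) x ω) / 2 := funext hTM
  change TendstoInDistribution (fun ν ω => centredStatistic (coeff G₀ (n ν))
    (weightMatrix (a ν) (b ν)) (μ ν) (Y ν) ω / σ ν) atTop id P (gaussianReal 0 1)
  rw [hfun]
  refine ⟨fun ν => (hmeas ν).aemeasurable, aemeasurable_id, ?_⟩
  refine ProbabilityMeasure.tendsto_iff_tendsto_charFun.2 fun t => ?_
  have hgauss : charFun ((gaussianReal 0 1).map id) t = Complex.exp (-(t ^ 2) / 2) := by
    rw [Measure.map_id, charFun_gaussianReal]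
    simp [neg_div]
  simp only [ProbabilityMeasure.coe_mk]
  rw [hgauss]
  simp_rw [halfFormCharFun_eq_charFun (hz _).measurable]
  exact hlim t
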